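/- Let $M$ and $N$ be smooth $n$-dimensional Riemannian manifolds, and let $\Omega\subset M$, $\Lambda\subset N$ be domains (non-empty connected open sets, not necessarily bounded). Let $c:\Omega\times\Lambda\to\mathbf R$ be a cost function and put $c^*(y,x)=c(x,y)$. Gradients are taken with respect to the Riemannian metrics, and $D^2_{xx}c$ denotes the Riemannian Hessian in $x$, i.e. the matrix of second derivatives in geodesic normal coordinates centered at the point $x$. Assume: (A0) $c\in C^4_{\rm loc}(\overline\Omega\times\overline\Lambda)$, i.e. $c$ is $C^4$ on $\Omega\times\Lambda$ and its derivatives of order at most $4$ extend continuously to $\overline\Omega\times\overline\Lambda$ (derivatives at boundary points below are these extensions); (A1) for every $x\in\Omega$ the map $y\mapsto-\nabla_xc(x,y)$ is injective on $\overline\Lambda$, and for every $y\in\Lambda$ the map $x\mapsto-\nabla_yc(x,y)$ is injective on $\overline\Omega$; (A2) $\det D^2_{xy}c(x,y)\neq0$ for all $x\in\overline\Omega$, $y\in\overline\Lambda$. For $x\in\Omega$ let $\mathrm{dom}(c\text{-Exp}_x)=\{-\nabla_xc(x,y): y\in\Lambda\}\subset T_xM$, and let $c\text{-Exp}_x\,p=y$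 if $y\in\Lambda$ and $p=-\nabla_xc(x,y)$. Assume further that $\Lambda$ is $c$-convex with respect to $\Omega$ (the set $\{-\nabla_xc(x,y): y\in\Lambda\}\subset T_xM$ is convex for every $x\in\Omega$) and that $\Omega$ is $c^*$-convex with respect to $\Lambda$ (the set $\{-\nabla_yc(x,y): x\in\Omega\}\subset T_yN$ is convex for every $y\in\Lambda$). For $(x,y)\in\Omega\times\Lambda$ and $\eta,\xi\in T_xM$ define the $c$-sectional curvature $$\mathfrak S_c(x,y)(\eta,\xi)=\frac{d^2}{dt^2}\Big|_{t=0}\big[-D^2_{xx}c\big]\big(x,\,c\text{-Exp}_x(p+t\xi)\big)\,\eta\,\eta,\qquad p=-\nabla_xc(x,y).$$ We say that $c$ satisfies A3W (resp. A3S) if there is a constant $C_0\ge0$ (resp. $C_0>0$) such that $\mathfrak S_c(x,y)(\eta,\xi)\ge C_0|\eta|^2|\xi|^2$ for all $(x,y)\in\Omega\times\Lambda$ and all $\eta,\xi\in T_xM$ with $\eta\perp\xi$. Given $x_m\in\Omega$ and $y_0,y_1\in\Lambda$, let $p_i=-\nabla_xc(x_m,y_i)$ for $i=0,1$, let $y_\theta=c\text{-Exp}_{x_m}\big((1-\theta)p_0+\theta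 p_1\big)$, which is defined for all $\theta$ in a neighbourhood of $[0,1]$, and for $x\in\Omega$ put $$f_\theta(x)=-c(x,y_\theta)+c(x_m,y_\theta),\qquad S_\theta=\Big\{x\in\Omega:\tfrac{d}{d\theta}f_\theta(x)=0\Big\},\qquad S^+_\theta=\Big\{x\in\Omega:\tfrac{d}{d\theta}f_\theta(x)\ge0\Big\}.$$ 1. If $c$ satisfies A3W, then for all $x_m\in\Omega$ and $y_0,y_1\in\Lambda$, $$S^+_{\theta_1}\subset S^+_{\theta_2}\quad\text{whenever }0\le\theta_1\le\theta_2\le1.$$ 2. If $c$ satisfies A3S, then for all $x_m\in\Omega$ and all $y_0,y_1\in\Lambda$ with $y_0\ne y_1$, the inclusions in 1 hold and moreover $$S_{\theta_1}\cap S_{\theta_2}=\{x_m\}\quad\text{whenever }0\le\theta_1<\theta_2\le1.$$ -/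

import Mathlib

open scoped Manifold ContDiff Topology
open Set Filter

namespace CostTransport

noncomputable section

/-- The model space `ℝⁿ`. -/
abbrev Euc (n : ℕ) : Type := EuclideanSpace ℝ (Fin n)

/-- Smooth Riemannian metrics on an `n`-dimensional manifold without boundary. -/
abbrev RMetric (n : ℕ) (M : Type*) [TopologicalSpace M] [ChartedSpace (Euc n) M]
    [IsManifold (𝓡 n) ∞ M] : Type _ :=
  Bundle.ContMDiffRiemannianMetric (𝓡 n) ∞ (Euc n) (fun x : M => TangentSpace (𝓡 n) x)

section Riemannian

variable {n : ℕ} {M : Type*} [TopologicalSpace M] [ChartedSpace (Euc n) M]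
  [IsManifold (𝓡 n) ∞ M]

/-- The isomorphism `T_x^* M → T_x M` given by the metric: the inverse of `v ↦ ⟨v, ·⟩`. -/
def sharp (g : RMetric n M) (x : M) :
    (TangentSpace (𝓡 n) x →L[ℝ] ℝ) →L[ℝ] TangentSpace (𝓡 n) x :=
  (g.inner x).inverse

theorem inner_isInvertible (g : RMetric n M) (x : M) : (g.inner x).IsInvertible := by
  have hinj : Function.Injective (g.inner x) := by
    rw [injective_iff_map_eq_zero]
    intro v hv
    by_contra hne
    have h := g.pos x v hne
    rw [hv] at h
    exact lt_irrefl _ h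
  let f : Euc n →L[ℝ] (Euc n →L[ℝ] ℝ) := g.inner x
  let A : Euc n →ₗ[ℝ] (Euc n →L[ℝ] ℝ) := f.toLinearMap
  have hrank : Module.finrank ℝ (Euc n) = Module.finrank ℝ (Euc n →L[ℝ] ℝ) := by
    rw [← (LinearMap.toContinuousLinearMap (𝕜 := ℝ) (E := Euc n) (F' := ℝ)).finrank_eq]
    exact Subspace.dual_finrank_eq.symm
  let e := LinearEquiv.ofInjectiveOfFinrankEq A hinj hrank
  exact ⟨e.toContinuousLinearEquiv, rfl⟩

theorem inner_sharp (g : RMetric n M) (x : M) (α : TangentSpace (𝓡 n) x →L[ℝ] ℝ)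
    (w : TangentSpace (𝓡 n) x) : g.inner x (sharp g x α) w = α w := by
  obtain ⟨e, he⟩ := inner_isInvertible g x
  have : g.inner x (sharp g x α) = α := by
    unfold sharp
    rw [← he, ContinuousLinearMap.inverse_equiv]
    exact e.apply_symm_apply α
  rw [this]

/-- The Riemannian gradient of `f` at `x`: `⟨∇f(x), w⟩ = df_x(w)` for all `w ∈ T_x M`. -/
def grad (g : RMetric n M) (f : M → ℝ) (x : M) : TangentSpace (𝓡 n) x :=
  sharp g x (mfderiv (𝓡 n) 𝓘(ℝ, ℝ) f x)

theorem inner_grad (g : RMetric n M) (f : M → ℝ) (x : M) (w : TangentSpace (𝓡 n) x) :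
    g.inner x (grad g f x) w = mfderiv (𝓡 n) 𝓘(ℝ, ℝ) f x w :=
  inner_sharp g x _ w

/-- The metric in the coordinates of the preferred chart at `x`: the bilinear form
`(g_ij(z))` at the coordinate point `z`. -/
def metricInChart (g : RMetric n M) (x : M) (z : Euc n) : Euc n →L[ℝ] Euc n →L[ℝ] ℝ :=
  let φ := extChartAt (𝓡 n) x
  let A : Euc n →L[ℝ] Euc n := mfderiv 𝓘(ℝ, Euc n) (𝓡 n) φ.symm z
  let G : Euc n →L[ℝ] Euc n →L[ℝ] ℝ := g.inner (φ.symm z)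
  G.bilinearComp A A

/-- The Christoffel symbols of the Levi-Civita connection at `x`, in the preferred chart at `x`:
`⟨Γ(u,v), w⟩ = (∂_u g(v,w) + ∂_v g(u,w) - ∂_w g(u,v)) / 2`. The coordinate basis of this chart
at `x` is the standard basis of `T_x M`. -/
def christoffel (g : RMetric n M) (x : M) (u v : TangentSpace (𝓡 n) x) : TangentSpace (𝓡 n) x :=
  let D : Euc n →L[ℝ] Euc n →L[ℝ] Euc n →L[ℝ] ℝ :=
    fderiv ℝ (metricInChart g x) (extChartAt (𝓡 n) x x)
  let u' : Euc n := u
  let v' : Euc n := v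
  sharp g x ((1 / 2 : ℝ) • (D u' v' + D v' u' - (D.flip u').flip v'))

/-- The Riemannian Hessian of `f` at `x`, `D²f(u,v) = ∂_u∂_v f - df(Γ(u,v))`, that is, the second
derivative of `f` in geodesic normal coordinates centered at `x`. -/
def hess (g : RMetric n M) (f : M → ℝ) (x : M) (u v : TangentSpace (𝓡 n) x) : ℝ :=
  let φ := extChartAt (𝓡 n) x
  let df : TangentSpace (𝓡 n) x →L[ℝ] ℝ := mfderiv (𝓡 n) 𝓘(ℝ, ℝ) f x
  fderiv ℝ (fderiv ℝ (f ∘ φ.symm)) (φ x) u v - df (christoffel g x u v)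

end Riemannian

section Cost

variable {n : ℕ}
  {M : Type*} [TopologicalSpace M] [ChartedSpace (Euc n) M] [IsManifold (𝓡 n) ∞ M]
  {N : Type*} [TopologicalSpace N] [ChartedSpace (Euc n) N] [IsManifold (𝓡 n) ∞ N]

/-- `c` in the coordinates of the preferred charts at `x₀` and `y₀`. -/
def costInChart (c : M → N → ℝ) (x₀ : M) (y₀ : N) (z : Euc n × Euc n) : ℝ :=
  c ((extChartAt (𝓡 n) x₀).symm z.1) ((extChartAt (𝓡 n) y₀).symm z.2)

/-- (A0): `c ∈ C⁴_loc(closure Ω × closure Λ)`. The cost is `C⁴` on `Ω × Λ`, and all its partial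
derivatives of order at most `4` in charts extend continuously to `closure Ω × closure Λ`
(they have a limit at each of its points). Only the values of `c` on `Ω × Λ` matter. -/
def A0 (n : ℕ) {M : Type*} [TopologicalSpace M] [ChartedSpace (Euc n) M]
    {N : Type*} [TopologicalSpace N] [ChartedSpace (Euc n) N]
    (c : M → N → ℝ) (Ω : Set M) (Λ : Set N) : Prop :=
  ContMDiffOn ((𝓡 n).prod (𝓡 n)) 𝓘(ℝ, ℝ) 4 (fun p : M × N => c p.1 p.2) (Ω ×ˢ Λ) ∧
  ∀ x₀ ∈ closure Ω, ∀ y₀ ∈ closure Λ, ∀ k : ℕ, k ≤ 4 →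
    ∃ L, Tendsto
      (fun p : M × N => iteratedFDeriv ℝ k (costInChart c x₀ y₀)
        (extChartAt (𝓡 n) x₀ p.1, extChartAt (𝓡 n) y₀ p.2))
      (𝓝[Ω ×ˢ Λ] (x₀, y₀)) (𝓝 L)

/-- The covector `-∇_x c(x, y)`, as a tangent vector at `x`. For the cost `c^*(y,x) = c(x,y)`,
that is for `fun y x => c x y`, this is `-∇_y c(x, y)`. -/
def momentum (g : RMetric n M) (c : M → N → ℝ) (x : M) (y : N) : TangentSpace (𝓡 n) x :=
  -grad g (fun x' => c x' y) x

/-- One half of (A1): for each `x ∈ Ω`, the map `y ↦ -∇_x c(x, y)`, extended from `Λ` to `closure Λ`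
by continuity, is injective on `closure Λ`. -/
def Twist (g : RMetric n M) (c : M → N → ℝ) (Ω : Set M) (Λ : Set N) : Prop :=
  ∀ x ∈ Ω, InjOn (extendFrom Λ (momentum g c x)) (closure Λ)

/-- (A1). -/
def A1 (g : RMetric n M) (h : RMetric n N) (c : M → N → ℝ) (Ω : Set M) (Λ : Set N) : Prop :=
  Twist g c Ω Λ ∧ Twist h (fun y x => c x y) Λ Ω

/-- The matrix `∂²c / ∂xᵢ∂yⱼ` at `p = (x, y)`, in the charts around `x₀` and `y₀`. -/
def mixedHess (n : ℕ) {M : Type*} [TopologicalSpace M] [ChartedSpace (Euc n) M]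
    {N : Type*} [TopologicalSpace N] [ChartedSpace (Euc n) N] (c : M → N → ℝ) (x₀ : M) (y₀ : N) (p : M × N) :
    Matrix (Fin n) (Fin n) ℝ :=
  Matrix.of fun i j =>
    fderiv ℝ (fderiv ℝ (costInChart c x₀ y₀))
      (extChartAt (𝓡 n) x₀ p.1, extChartAt (𝓡 n) y₀ p.2)
      (0, EuclideanSpace.single j (1 : ℝ)) (EuclideanSpace.single i (1 : ℝ), 0)

/-- (A2): `det D²_{xy} c ≠ 0` on `closure Ω × closure Λ`, the second derivatives being extended from
`Ω × Λ` by continuity. (Whether the determinant vanishes does not depend on the charts.) -/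
def A2 (n : ℕ) {M : Type*} [TopologicalSpace M] [ChartedSpace (Euc n) M]
    {N : Type*} [TopologicalSpace N] [ChartedSpace (Euc n) N]
    (c : M → N → ℝ) (Ω : Set M) (Λ : Set N) : Prop :=
  ∀ x ∈ closure Ω, ∀ y ∈ closure Λ,
    (extendFrom (Ω ×ˢ Λ) (mixedHess n c x y) (x, y)).det ≠ 0

/-- `dom(c-Exp_x) = (c-Exp_x)⁻¹ Λ`, the set of all `-∇_x c(x, y)` with `y ∈ Λ`. -/
def domCExp (g : RMetric n M) (c : M → N → ℝ) (Λ : Set N) (x : M) : Set (TangentSpace (𝓡 n) x) :=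
  momentum g c x '' Λ

/-- The `c`-exponential map: `c-Exp_x p = y` if `y ∈ Λ` and `p = -∇_x c(x, y)`
(with an unspecified value for `p` outside `domCExp`). -/
def cExp [Nonempty N] (g : RMetric n M) (c : M → N → ℝ) (Λ : Set N) (x : M)
    (p : TangentSpace (𝓡 n) x) : N :=
  Function.invFunOn (momentum g c x) Λ p

/-- `Λ` is `c`-convex with respect to `Ω`. The `c^*`-convexity of `Ω` with respect to `Λ` is
this notion for the cost `fun y x => c x y`. -/
def CConvex (g : RMetric n M) (c : M → N → ℝ) (Ω : Set M) (Λ : Set N) : Prop :=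
  ∀ x ∈ Ω, Convex ℝ (domCExp g c Λ x)

/-- The `c`-sectional curvature
`𝔖_c(x,y)(η,ξ) = d²/dt²|_{t=0} [-D²_{xx} c](x, c-Exp_x(p + tξ)) η η`, `p = -∇_x c(x,y)`. -/
def cSectionalCurvature [Nonempty N] (g : RMetric n M) (c : M → N → ℝ) (Λ : Set N)
    (x : M) (y : N) (η ξ : TangentSpace (𝓡 n) x) : ℝ :=
  iteratedDeriv 2
    (fun t : ℝ => -hess g (fun x' => c x' (cExp g c Λ x (momentum g c x y + t • ξ))) x η η) 0

/-- `𝔖_c(x,y)(η,ξ) ≥ C₀ |η|² |ξ|²` for all `(x,y) ∈ Ω × Λ` and all `η ⟂ ξ` in `T_x M`. -/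
def CurvatureBound [Nonempty N] (g : RMetric n M) (c : M → N → ℝ) (Ω : Set M) (Λ : Set N)
    (C₀ : ℝ) : Prop :=
  ∀ x ∈ Ω, ∀ y ∈ Λ, ∀ η ξ : TangentSpace (𝓡 n) x, g.inner x η ξ = 0 →
    C₀ * g.inner x η η * g.inner x ξ ξ ≤ cSectionalCurvature g c Λ x y η ξ

/-- (A3W). -/
def A3W [Nonempty N] (g : RMetric n M) (c : M → N → ℝ) (Ω : Set M) (Λ : Set N) : Prop :=
  ∃ C₀ : ℝ, 0 ≤ C₀ ∧ CurvatureBound g c Ω Λ C₀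

/-- (A3S). -/
def A3S [Nonempty N] (g : RMetric n M) (c : M → N → ℝ) (Ω : Set M) (Λ : Set N) : Prop :=
  ∃ C₀ : ℝ, 0 < C₀ ∧ CurvatureBound g c Ω Λ C₀

/-- `y_θ = c-Exp_{x_m}((1-θ) p₀ + θ p₁)` with `p_i = -∇_x c(x_m, y_i)`; for `θ ∈ [0,1]` this is
the `c`-segment from `y₀` to `y₁` with respect to `x_m`. -/
def cSegment [Nonempty N] (g : RMetric n M) (c : M → N → ℝ) (Λ : Set N) (xm : M) (y₀ y₁ : N)
    (θ : ℝ) : N :=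
  cExp g c Λ xm ((1 - θ) • momentum g c xm y₀ + θ • momentum g c xm y₁)

/-- The sliding mountain `f_θ(x) = -c(x, y_θ) + c(x_m, y_θ)`. -/
def slidingMountain [Nonempty N] (g : RMetric n M) (c : M → N → ℝ) (Λ : Set N) (xm : M)
    (y₀ y₁ : N) (θ : ℝ) (x : M) : ℝ :=
  -c x (cSegment g c Λ xm y₀ y₁ θ) + c xm (cSegment g c Λ xm y₀ y₁ θ)

/-- The level set `S_θ = {x ∈ Ω | (d/dθ) f_θ(x) = 0}`. -/
def levelSet [Nonempty N] (g : RMetric n M) (c : M → N → ℝ) (Ω : Set M) (Λ : Set N) (xm : M)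
    (y₀ y₁ : N) (θ : ℝ) : Set M :=
  {x ∈ Ω | deriv (fun s => slidingMountain g c Λ xm y₀ y₁ s x) θ = 0}

/-- The super-level set `S⁺_θ = {x ∈ Ω | (d/dθ) f_θ(x) ≥ 0}`. -/
def superLevelSet [Nonempty N] (g : RMetric n M) (c : M → N → ℝ) (Ω : Set M) (Λ : Set N) (xm : M)
    (y₀ y₁ : N) (θ : ℝ) : Set M :=
  {x ∈ Ω | 0 ≤ deriv (fun s => slidingMountain g c Λ xm y₀ y₁ s x) θ}

/-- (Monotonicity): `S⁺_{θ₁} ⊆ S⁺_{θ₂}` for `0 ≤ θ₁ ≤ θ₂ ≤ 1`. -/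
def Monotonicity [Nonempty N] (g : RMetric n M) (c : M → N → ℝ) (Ω : Set M) (Λ : Set N) (xm : M)
    (y₀ y₁ : N) : Prop :=
  ∀ θ₁ θ₂ : ℝ, 0 ≤ θ₁ → θ₁ ≤ θ₂ → θ₂ ≤ 1 →
    superLevelSet g c Ω Λ xm y₀ y₁ θ₁ ⊆ superLevelSet g c Ω Λ xm y₀ y₁ θ₂

/-- (Strict Monotonicity): monotonicity, and `S_{θ₁} ∩ S_{θ₂} = {x_m}` for `0 ≤ θ₁ < θ₂ ≤ 1`. -/
def StrictMonotonicity [Nonempty N] (g : RMetric n M) (c : M → N → ℝ) (Ω : Set M) (Λ : Set N)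
    (xm : M) (y₀ y₁ : N) : Prop :=
  Monotonicity g c Ω Λ xm y₀ y₁ ∧
  ∀ θ₁ θ₂ : ℝ, 0 ≤ θ₁ → θ₁ < θ₂ → θ₂ ≤ 1 →
    levelSet g c Ω Λ xm y₀ y₁ θ₁ ∩ levelSet g c Ω Λ xm y₀ y₁ θ₂ = {xm}

end Cost

end

end CostTransport

namespace CostTransport

noncomputable section

set_option linter.unusedSectionVars false

section DirectionalDerivative

variable {V : Type*} [NormedAddCommGroup V] [NormedSpace ℝ V]

/-- The derivative of `f` in the constant direction `a`. -/
def dirD (a : V) (f : V → ℝ) (p : V) : ℝ := fderiv ℝ f p a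

/-- The second derivative of `f` along a curve with velocity `a` and acceleration `a'`. -/
def dirQ (a a' : V) (f : V → ℝ) (p : V) : ℝ := dirD a (dirD a f) p + dirD a' f p

theorem contDiffAt_dirD {f : V → ℝ} {p : V} {m k : WithTop ℕ∞} (hf : ContDiffAt ℝ k f p)
    (hk : m + 1 ≤ k) (a : V) : ContDiffAt ℝ m (dirD a f) p :=
  (hf.fderiv_right hk).clm_apply contDiffAt_const

theorem contDiffAt_dirQ {f : V → ℝ} {p : V} {m k : WithTop ℕ∞} (hf : ContDiffAt ℝ k f p)
    (hk : m + 2 ≤ k) (a a' : V) : ContDiffAt ℝ m (dirQ a a' f) p := by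
  have h1 : m + 1 + 1 ≤ k := by rwa [add_assoc, one_add_one_eq_two]
  have h2 : m + 1 ≤ k := le_trans le_self_add h1
  exact (contDiffAt_dirD (contDiffAt_dirD hf h1 a) le_rfl a).add (contDiffAt_dirD hf h2 a')

theorem dirD_congr {f g : V → ℝ} {p : V} (h : f =ᶠ[𝓝 p] g) (a : V) :
    dirD a f =ᶠ[𝓝 p] dirD a g := by
  filter_upwards [h.eventuallyEq_nhds] with q hq
  simp only [dirD, hq.fderiv_eq]

theorem dirD_dirD {f : V → ℝ} {p : V} (hf : ContDiffAt ℝ 2 f p) (a b : V) :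
    dirD a (dirD b f) p = fderiv ℝ (fderiv ℝ f) p a b := by
  have h : DifferentiableAt ℝ (fderiv ℝ f) p :=
    (hf.fderiv_right (m := 1) (by norm_num)).differentiableAt one_ne_zero
  have h' : HasFDerivAt (fun q => fderiv ℝ f q b) _ p :=
    h.hasFDerivAt.clm_apply (hasFDerivAt_const b p)
  simp only [dirD]
  change fderiv ℝ (fun q => fderiv ℝ f q b) p a = _
  rw [h'.fderiv]
  simp

theorem dirD_comm {f : V → ℝ} {p : V} (hf : ContDiffAt ℝ 2 f p) (a b : V) :
    dirD a (dirD b f) p = dirD b (dirD a f) p := by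
  rw [dirD_dirD hf, dirD_dirD hf]
  exact (hf.isSymmSndFDerivAt (by simp)).eq a b

theorem eventually_contDiffAt {f : V → ℝ} {p : V} {k : ℕ} (hf : ContDiffAt ℝ k f p) :
    ∀ᶠ q in 𝓝 p, ContDiffAt ℝ k f q :=
  hf.eventually (by simp)

theorem dirD_comm_eventually {f : V → ℝ} {p : V} (hf : ContDiffAt ℝ 2 f p) (a b : V) :
    dirD a (dirD b f) =ᶠ[𝓝 p] dirD b (dirD a f) := by
  filter_upwards [eventually_contDiffAt (k := 2) hf] with q hq
  exact dirD_comm hq a b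

theorem dirD_add {f g : V → ℝ} {p : V} (hf : DifferentiableAt ℝ f p)
    (hg : DifferentiableAt ℝ g p) (a : V) :
    dirD a (fun q => f q + g q) p = dirD a f p + dirD a g p := by
  simp only [dirD, fderiv_fun_add hf hg, add_apply]

theorem dirQ_add {f g : V → ℝ} {p : V} (hf : ContDiffAt ℝ 2 f p) (hg : ContDiffAt ℝ 2 g p)
    (a a' : V) : dirQ a a' (fun q => f q + g q) p = dirQ a a' f p + dirQ a a' g p := by
  have h : dirD a (fun q => f q + g q) =ᶠ[𝓝 p] fun q => dirD a f q + dirD a g q := by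
    filter_upwards [eventually_contDiffAt (k := 2) hf, eventually_contDiffAt (k := 2) hg]
      with q hf hg
    exact dirD_add (hf.differentiableAt (by norm_num)) (hg.differentiableAt (by norm_num)) a
  simp only [dirQ]
  rw [(dirD_congr h a).eq_of_nhds, dirD_add, dirD_add]
  · ring
  · exact hf.differentiableAt (by norm_num)
  · exact hg.differentiableAt (by norm_num)
  · exact (contDiffAt_dirD (m := 1) hf (by norm_num) a).differentiableAt one_ne_zero
  · exact (contDiffAt_dirD (m := 1) hg (by norm_num) a).differentiableAt one_ne_zero

theorem dirQ_dirD_comm {f : V → ℝ} {p : V} (hf : ContDiffAt ℝ 3 f p) (a a' b : V) :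
    dirQ a a' (dirD b f) p = dirD b (dirQ a a' f) p := by
  have h2 : ContDiffAt ℝ 2 f p := hf.of_le (by norm_num)
  have ha : ContDiffAt ℝ 2 (dirD a f) p := contDiffAt_dirD hf (by norm_num) a
  have e : dirD a (dirD a (dirD b f)) p = dirD b (dirD a (dirD a f)) p := by
    rw [(dirD_congr (dirD_comm_eventually h2 a b) a).eq_of_nhds, dirD_comm ha]
  have : dirD b (dirQ a a' f) p = dirD b (dirD a (dirD a f)) p + dirD b (dirD a' f) p :=
    dirD_add ((contDiffAt_dirD (m := 1) ha (by norm_num) a).differentiableAt one_ne_zero)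
      ((contDiffAt_dirD (m := 1) h2 (by norm_num) a').differentiableAt one_ne_zero) b
  rw [this, dirQ, e, dirD_comm h2]

theorem dirQ_comm {f : V → ℝ} {p : V} (hf : ContDiffAt ℝ 4 f p) (a a' b b' : V) :
    dirQ a a' (dirQ b b' f) p = dirQ b b' (dirQ a a' f) p := by
  have h3 : ContDiffAt ℝ 3 f p := hf.of_le (by norm_num)
  have hb : ContDiffAt ℝ 3 (dirD b f) p := contDiffAt_dirD hf (by norm_num) b
  have h1 : dirQ a a' (dirQ b b' f) p
      = dirQ a a' (dirD b (dirD b f)) p + dirQ a a' (dirD b' f) p :=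
    dirQ_add (contDiffAt_dirD hb (by norm_num) b) (contDiffAt_dirD h3 (by norm_num) b') a a'
  have h2 : dirQ a a' (dirD b f) =ᶠ[𝓝 p] dirD b (dirQ a a' f) := by
    filter_upwards [eventually_contDiffAt (k := 3) h3] with q hq
    exact dirQ_dirD_comm hq a a' b
  rw [h1, dirQ_dirD_comm hb, dirQ_dirD_comm h3, (dirD_congr h2 b).eq_of_nhds, dirQ]

theorem hasDerivAt_comp_curve {f : V → ℝ} {γ : ℝ → V} {s : ℝ} (hf : DifferentiableAt ℝ f (γ s))
    (hγ : DifferentiableAt ℝ γ s) : HasDerivAt (fun r => f (γ r)) (dirD (deriv γ s) f (γ s)) s :=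
  hf.hasFDerivAt.comp_hasDerivAt s hγ.hasDerivAt

theorem contDiffAt_deriv {γ : ℝ → V} {s : ℝ} {m k : WithTop ℕ∞} (hγ : ContDiffAt ℝ k γ s)
    (hk : m + 1 ≤ k) : ContDiffAt ℝ m (deriv γ) s :=
  (hγ.fderiv_right hk).clm_apply (contDiffAt_const (c := (1 : ℝ)))

/-- The second derivative of a function along a curve. -/
theorem deriv_deriv_comp_curve {f : V → ℝ} {γ : ℝ → V} {s : ℝ} (hf : ContDiffAt ℝ 2 f (γ s))
    (hγ : ContDiffAt ℝ 2 γ s) :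
    deriv (deriv fun r => f (γ r)) s = dirQ (deriv γ s) (deriv (deriv γ) s) f (γ s) := by
  have h : deriv (fun r => f (γ r)) =ᶠ[𝓝 s] fun r => fderiv ℝ f (γ r) (deriv γ r) := by
    filter_upwards [hγ.continuousAt.eventually (eventually_contDiffAt (k := 2) hf),
      hγ.eventually (by simp)] with r h1 h2
    exact (hasDerivAt_comp_curve (h1.differentiableAt (by norm_num))
      (h2.differentiableAt (by norm_num))).deriv
  rw [h.deriv_eq]
  have h1 : DifferentiableAt ℝ (fderiv ℝ f) (γ s) :=
    (hf.fderiv_right (m := 1) (by norm_num)).differentiableAt one_ne_zero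
  have h2 : DifferentiableAt ℝ (deriv γ) s :=
    (contDiffAt_deriv (m := 1) hγ (by norm_num)).differentiableAt one_ne_zero
  have h3 := (h1.hasFDerivAt.comp_hasDerivAt s
    (hγ.differentiableAt (by norm_num)).hasDerivAt).clm_apply h2.hasDerivAt
  rw [show (fun r => fderiv ℝ f (γ r) (deriv γ r))
    = fun r => ((fderiv ℝ f ∘ γ) r) (deriv γ r) from rfl, h3.deriv, dirQ, dirD_dirD hf]
  simp [dirD]

end DirectionalDerivative

section Regular

variable {n : ℕ}
  {M : Type*} [TopologicalSpace M] [ChartedSpace (Euc n) M] [IsManifold (𝓡 n) ∞ M]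
  {N : Type*} [TopologicalSpace N] [ChartedSpace (Euc n) N] [IsManifold (𝓡 n) ∞ N]

/-- The metric at `x` as a bilinear form on the model space. -/
def metricAt (g : RMetric n M) (x : M) : Euc n →L[ℝ] Euc n →L[ℝ] ℝ := g.inner x

/-- The vector `-∇_x c(x, y)` as an element of the model space. -/
def mom (g : RMetric n M) (c : M → N → ℝ) (x : M) (y : N) : Euc n := momentum g c x y

/-- The coordinates of `(x, y)` in the preferred charts at `x` and `y`. -/
def chartPt (n : ℕ) {M : Type*} [TopologicalSpace M] [ChartedSpace (Euc n) M]
    {N : Type*} [TopologicalSpace N] [ChartedSpace (Euc n) N] (x : M) (y : N) :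
    Euc n × Euc n :=
  (extChartAt (𝓡 n) x x, extChartAt (𝓡 n) y y)

theorem metricAt_symm (g : RMetric n M) (x : M) (u v : Euc n) :
    metricAt g x u v = metricAt g x v u := g.symm x u v

theorem metricAt_pos (g : RMetric n M) (x : M) {u : Euc n} (hu : u ≠ 0) :
    0 < metricAt g x u u := g.pos x u hu

theorem metricAt_injective (g : RMetric n M) (x : M) : Function.Injective (metricAt g x) := by
  intro u v huv
  by_contra hne
  have h := metricAt_pos g x (sub_ne_zero.2 hne)
  rw [map_sub (metricAt g x), huv, sub_self] at h
  exact lt_irrefl (0 : ℝ) h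

theorem costInChart_swap (c : M → N → ℝ) (x : M) (y : N) :
    costInChart (n := n) (fun y x => c x y) y x = costInChart c x y ∘ Prod.swap := rfl

/-- A cost that is smooth in charts on a product of open sets. -/
structure SmoothCost (n : ℕ) {M : Type*} [TopologicalSpace M] [ChartedSpace (Euc n) M]
    {N : Type*} [TopologicalSpace N] [ChartedSpace (Euc n) N]
    (c : M → N → ℝ) (Ω : Set M) (Λ : Set N) : Prop where
  isOpen_left : IsOpen Ω
  isOpen_right : IsOpen Λ
  contDiffAt : ∀ x ∈ Ω, ∀ y ∈ Λ, ContDiffAt ℝ 4 (costInChart c x y) (chartPt n x y)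
  mdifferentiableAt : ∀ x ∈ Ω, ∀ y ∈ Λ, MDifferentiableAt (𝓡 n) 𝓘(ℝ, ℝ) (fun z => c z y) x

/-- The one-sided hypotheses on a cost: smoothness and nondegeneracy in charts, injectivity of
`y ↦ -∇_x c(x, y)` and convexity of its range. -/
structure Regular (g : RMetric n M) (c : M → N → ℝ) (Ω : Set M) (Λ : Set N) : Prop
    extends SmoothCost n c Ω Λ where
  nondeg : ∀ x ∈ Ω, ∀ y ∈ Λ, ∀ v : Euc n,
    (∀ u : Euc n, dirD (0, v) (dirD (u, 0) (costInChart c x y)) (chartPt n x y) = 0) → v = 0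
  injOn : ∀ x ∈ Ω, InjOn (mom g c x) Λ
  convex : ∀ x ∈ Ω, Convex ℝ (mom g c x '' Λ)

theorem eventually_symm_mem {Λ : Set N} (hΛ : IsOpen Λ) {y : N} (hy : y ∈ Λ) :
    ∀ᶠ w in 𝓝 (extChartAt (𝓡 n) y y), (extChartAt (𝓡 n) y).symm w ∈ Λ := by
  have h := continuousAt_extChartAt_symm (I := 𝓡 n) y
  exact h.eventually (by rw [extChartAt_to_inv]; exact hΛ.mem_nhds hy)

theorem mfderiv_eq_fderiv_chart {f : M → ℝ} {x : M} (hf : MDifferentiableAt (𝓡 n) 𝓘(ℝ, ℝ) f x) :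
    (mfderiv (𝓡 n) 𝓘(ℝ, ℝ) f x : Euc n →L[ℝ] ℝ)
      = fderiv ℝ (f ∘ (extChartAt (𝓡 n) x).symm) (extChartAt (𝓡 n) x x) := by
  have h := hf.mfderiv
  rw [writtenInExtChartAt] at h
  simp only [mfld_simps, fderivWithin_univ] at h
  exact h

theorem dirD_comp_prodMk_left {f : Euc n × Euc n → ℝ} {z w : Euc n}
    (hf : DifferentiableAt ℝ f (z, w)) (u : Euc n) :
    fderiv ℝ (fun z' => f (z', w)) z u = dirD (u, 0) f (z, w) := by
  have h := HasFDerivAt.comp (g := f) z hf.hasFDerivAt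
    ((hasFDerivAt_id (𝕜 := ℝ) z).prodMk (hasFDerivAt_const w z))
  have h' : fderiv ℝ (fun z' => f (z', w)) z = _ := h.fderiv
  rw [h']
  simp [dirD]

theorem metricAt_mom_mfderiv (g : RMetric n M) (c : M → N → ℝ) (x : M) (y : N) (u : Euc n) :
    metricAt g x (mom g c x y) u
      = -(mfderiv (𝓡 n) 𝓘(ℝ, ℝ) (fun x' => c x' y) x : Euc n →L[ℝ] ℝ) u := by
  let G : Euc n := grad g (fun x' => c x' y) x
  have hG : metricAt g x G u = (mfderiv (𝓡 n) 𝓘(ℝ, ℝ) (fun x' => c x' y) x : Euc n →L[ℝ] ℝ) u :=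
    inner_grad g (fun x' => c x' y) x u
  have hm : mom g c x y = -G := rfl
  rw [hm, map_neg, neg_apply, hG]
  rfl

namespace SmoothCost

variable {c : M → N → ℝ} {Ω : Set M} {Λ : Set N}

theorem metricAt_mom (H : SmoothCost n c Ω Λ) (g : RMetric n M) {x : M} (hx : x ∈ Ω) {y : N} (hy : y ∈ Λ) (u : Euc n) :
    metricAt g x (mom g c x y) u
      = -fderiv ℝ (fun z => c ((extChartAt (𝓡 n) x).symm z) y) (extChartAt (𝓡 n) x x) u := by
  rw [metricAt_mom_mfderiv, mfderiv_eq_fderiv_chart (H.mdifferentiableAt x hx y hy)]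
  rfl

theorem eventually_contDiffAt_right (H : SmoothCost n c Ω Λ) {x : M} (hx : x ∈ Ω) {y : N} (hy : y ∈ Λ) :
    ∀ᶠ w in 𝓝 (extChartAt (𝓡 n) y y),
      ContDiffAt ℝ 4 (costInChart c x y) (extChartAt (𝓡 n) x x, w) := by
  have h1 := eventually_contDiffAt (k := 4) (H.contDiffAt x hx y hy)
  have h2 : ContinuousAt (fun w : Euc n => (extChartAt (𝓡 n) x x, w)) (extChartAt (𝓡 n) y y) := by
    fun_prop
  exact h2.eventually h1

theorem eventually_metricAt_mom (H : SmoothCost n c Ω Λ) (g : RMetric n M) {x : M} (hx : x ∈ Ω) {y : N} (hy : y ∈ Λ) :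
    ∀ᶠ w in 𝓝 (extChartAt (𝓡 n) y y), ∀ u : Euc n,
      metricAt g x (mom g c x ((extChartAt (𝓡 n) y).symm w)) u
        = -dirD (u, 0) (costInChart c x y) (extChartAt (𝓡 n) x x, w) := by
  filter_upwards [eventually_symm_mem H.isOpen_right hy, H.eventually_contDiffAt_right hx hy]
    with w hw hd u
  rw [H.metricAt_mom g hx hw, ← dirD_comp_prodMk_left (hd.differentiableAt (by norm_num))]
  rfl

theorem dirD_costInChart (H : SmoothCost n c Ω Λ) (g : RMetric n M) {x : M} (hx : x ∈ Ω) {y : N} (hy : y ∈ Λ)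
    (u : Euc n) : dirD (u, 0) (costInChart c x y) (chartPt n x y) = -metricAt g x (mom g c x y) u := by
  have h := (H.eventually_metricAt_mom g hx hy).self_of_nhds u
  rw [extChartAt_to_inv] at h
  rw [h, neg_neg, chartPt]

end SmoothCost

end Regular

section CExponential

variable {n : ℕ}
  {M : Type*} [TopologicalSpace M] [ChartedSpace (Euc n) M] [IsManifold (𝓡 n) ∞ M]
  {N : Type*} [TopologicalSpace N] [ChartedSpace (Euc n) N] [IsManifold (𝓡 n) ∞ N]

theorem exists_equiv_of_injective (A : Euc n →L[ℝ] (Euc n →L[ℝ] ℝ)) (hA : Function.Injective A) :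
    ∃ e : Euc n ≃L[ℝ] (Euc n →L[ℝ] ℝ), (e : Euc n →L[ℝ] (Euc n →L[ℝ] ℝ)) = A := by
  have hrank : Module.finrank ℝ (Euc n) = Module.finrank ℝ (Euc n →L[ℝ] ℝ) := by
    rw [← (LinearMap.toContinuousLinearMap (𝕜 := ℝ) (E := Euc n) (F' := ℝ)).finrank_eq]
    exact Subspace.dual_finrank_eq.symm
  exact ⟨(LinearEquiv.ofInjectiveOfFinrankEq A.toLinearMap hA hrank).toContinuousLinearEquiv, rfl⟩

theorem metricAt_surjective (g : RMetric n M) (x : M) : Function.Surjective (metricAt g x) := by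
  obtain ⟨e, he⟩ := exists_equiv_of_injective _ (metricAt_injective g x)
  rw [← he]
  exact e.surjective

/-- The `c`-exponential map on the model space. -/
def cE [Nonempty N] (g : RMetric n M) (c : M → N → ℝ) (Λ : Set N) (x : M) (p : Euc n) : N :=
  cExp g c Λ x p

theorem cE_mem [Nonempty N] {g : RMetric n M} {c : M → N → ℝ} {Λ : Set N} {x : M} {p : Euc n}
    (hp : p ∈ mom g c x '' Λ) : cE g c Λ x p ∈ Λ :=
  Function.invFunOn_mem hp

theorem mom_cE [Nonempty N] {g : RMetric n M} {c : M → N → ℝ} {Λ : Set N} {x : M} {p : Euc n}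
    (hp : p ∈ mom g c x '' Λ) : mom g c x (cE g c Λ x p) = p :=
  Function.invFunOn_eq hp

namespace Regular

variable {g : RMetric n M} {c : M → N → ℝ} {Ω : Set M} {Λ : Set N}

theorem cE_mom [Nonempty N] (H : Regular g c Ω Λ) {x : M} (hx : x ∈ Ω) {y : N} (hy : y ∈ Λ) :
    cE g c Λ x (mom g c x y) = y :=
  have h : mom g c x y ∈ mom g c x '' Λ := mem_image_of_mem _ hy
  H.injOn x hx (cE_mem h) hy (mom_cE h)

/-- Near `-∇_x c(x, y)` the `c`-exponential map is defined and it is `C³` in charts. -/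
theorem cE_local [Nonempty N] (H : Regular g c Ω Λ) {x : M} (hx : x ∈ Ω) {y : N} (hy : y ∈ Λ) :
    ContDiffAt ℝ 3 (fun p => extChartAt (𝓡 n) y (cE g c Λ x p)) (mom g c x y) ∧
    ∀ᶠ p in 𝓝 (mom g c x y), p ∈ mom g c x '' Λ ∧ cE g c Λ x p ∈ (extChartAt (𝓡 n) y).source := by
  set ψ := extChartAt (𝓡 n) y with hψ
  set z₀ : Euc n := extChartAt (𝓡 n) x x with hz₀
  set w₀ : Euc n := ψ y with hw₀
  have hc : ContDiffAt ℝ 4 (costInChart c x y) (z₀, w₀) := H.contDiffAt x hx y hy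
  let K : Euc n → (Euc n →L[ℝ] ℝ) := fun w =>
    -((fderiv ℝ (costInChart c x y) (z₀, w)).comp (ContinuousLinearMap.inl ℝ (Euc n) (Euc n)))
  have hKu : ∀ w u, K w u = -dirD (u, 0) (costInChart c x y) (z₀, w) := fun w u => by
    simp [K, dirD]
  have hK : ContDiffAt ℝ 3 K w₀ := by
    have h1 : ContDiffAt ℝ 3 (fderiv ℝ (costInChart c x y)) (z₀, w₀) :=
      hc.fderiv_right (by norm_num)
    have h2 : ContDiffAt ℝ 3 (fun w : Euc n => (z₀, w)) w₀ := by fun_prop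
    have h3 : ContDiffAt ℝ 3 (fun w : Euc n => fderiv ℝ (costInChart c x y) (z₀, w)) w₀ :=
      ContDiffAt.comp (g := fderiv ℝ (costInChart c x y)) w₀ h1 h2
    exact (h3.clm_comp contDiffAt_const).neg
  have hK' : HasFDerivAt K (fderiv ℝ K w₀) w₀ :=
    (hK.differentiableAt (by norm_num)).hasFDerivAt
  have hinj : Function.Injective (fderiv ℝ K w₀) := by
    rw [injective_iff_map_eq_zero]
    intro v hv
    refine H.nondeg x hx y hy v fun u => ?_
    have h1 : HasFDerivAt (fun w => K w u) _ w₀ := hK'.clm_apply (hasFDerivAt_const u w₀)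
    have hd : DifferentiableAt ℝ (dirD (u, 0) (costInChart c x y)) (z₀, w₀) :=
      (contDiffAt_dirD (m := 1) hc (by norm_num) (u, 0)).differentiableAt one_ne_zero
    have h2 := (HasFDerivAt.comp (g := dirD (u, 0) (costInChart c x y)) w₀ hd.hasFDerivAt
      ((hasFDerivAt_const z₀ w₀).prodMk (hasFDerivAt_id w₀))).neg
    have h3 := h1.unique (h2.congr_of_eventuallyEq (Eventually.of_forall fun w => hKu w u))
    have h4 := congrArg (fun T : Euc n →L[ℝ] ℝ => T v) h3
    simp [hv] at h4
    exact h4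
  obtain ⟨e, he⟩ := exists_equiv_of_injective _ hinj
  rw [← he] at hK'
  let σ := hK.localInverse hK' (by norm_num)
  have hσ : ContDiffAt ℝ 3 σ (K w₀) := hK.to_localInverse hK' (by norm_num)
  have hσ₀ : σ (K w₀) = w₀ := hK.localInverse_apply_image hK' (by norm_num)
  have hKσ : ∀ᶠ q in 𝓝 (K w₀), K (σ q) = q :=
    (hK.hasStrictFDerivAt' hK' (by norm_num)).eventually_right_inverse
  have hm₀ : metricAt g x (mom g c x y) = K w₀ := by
    ext u
    rw [hKu]
    have := H.dirD_costInChart g hx hy u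
    rw [chartPt] at this
    rw [this, neg_neg]
  have hB : ContinuousAt (metricAt g x) (mom g c x y) := (metricAt g x).continuous.continuousAt
  rw [← hm₀] at hσ hσ₀ hKσ
  have hσB : ContinuousAt (fun p => σ (metricAt g x p)) (mom g c x y) :=
    ContinuousAt.comp (g := σ) hσ.continuousAt hB
  have hev : ∀ᶠ p in 𝓝 (mom g c x y), σ (metricAt g x p) ∈ ψ.target ∧
      ψ.symm (σ (metricAt g x p)) ∈ Λ ∧
      mom g c x (ψ.symm (σ (metricAt g x p))) = p := by
    have ht : Tendsto (fun p => σ (metricAt g x p)) (𝓝 (mom g c x y)) (𝓝 w₀) := by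
      have := hσB.tendsto
      rwa [hσ₀] at this
    filter_upwards [hB.eventually hKσ, ht.eventually (eventually_symm_mem H.isOpen_right hy),
      ht.eventually (H.eventually_metricAt_mom g hx hy),
      ht.eventually (extChartAt_target_mem_nhds (I := 𝓡 n) y)] with p h1 h2 h3 h4
    refine ⟨h4, h2, metricAt_injective g x ?_⟩
    ext u
    rw [h3 u, ← hKu, h1]
  have hcE : ∀ᶠ p in 𝓝 (mom g c x y), cE g c Λ x p = ψ.symm (σ (metricAt g x p)) := by
    filter_upwards [hev] with p hp
    have := H.cE_mom hx hp.2.1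
    rwa [hp.2.2] at this
  constructor
  · have h1 : ContDiffAt ℝ 3 (fun p => σ (metricAt g x p)) (mom g c x y) :=
      ContDiffAt.comp (g := σ) _ hσ (metricAt g x).contDiff.contDiffAt
    refine h1.congr_of_eventuallyEq ?_
    filter_upwards [hev, hcE] with p hp hp'
    rw [hp', ψ.right_inv hp.1]
  · filter_upwards [hev, hcE] with p hp hp'
    refine ⟨⟨_, hp.2.1, hp.2.2⟩, ?_⟩
    rw [hp']
    exact ψ.map_target hp.1

end Regular

end CExponential

section ProductCurves

variable {E F : Type*} [NormedAddCommGroup E] [NormedSpace ℝ E] [NormedAddCommGroup F]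
  [NormedSpace ℝ F]

theorem deriv_prodMk_const_left {w : ℝ → F} {t : ℝ} (z : E) (hw : DifferentiableAt ℝ w t) :
    deriv (fun s => (z, w s)) t = ((0 : E), deriv w t) :=
  ((hasDerivAt_const t z).prodMk hw.hasDerivAt).deriv

theorem deriv_prodMk_const_right {w : ℝ → F} {t : ℝ} (z : E) (hw : DifferentiableAt ℝ w t) :
    deriv (fun s => (w s, z)) t = (deriv w t, (0 : E)) :=
  (hw.hasDerivAt.prodMk (hasDerivAt_const t z)).deriv

theorem eventually_differentiableAt {w : ℝ → F} {t : ℝ} (hw : ContDiffAt ℝ 2 w t) :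
    ∀ᶠ s in 𝓝 t, DifferentiableAt ℝ w s := by
  filter_upwards [hw.eventually (by simp)] with s hs using hs.differentiableAt (by norm_num)

theorem differentiableAt_deriv {w : ℝ → F} {t : ℝ} (hw : ContDiffAt ℝ 2 w t) :
    DifferentiableAt ℝ (deriv w) t :=
  (contDiffAt_deriv (m := 1) hw (by norm_num)).differentiableAt one_ne_zero

theorem deriv_deriv_right {f : E × F → ℝ} {w : ℝ → F} {t : ℝ} {z : E}
    (hf : ContDiffAt ℝ 2 f (z, w t)) (hw : ContDiffAt ℝ 2 w t) :
    deriv (deriv fun s => f (z, w s)) t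
      = dirQ (0, deriv w t) (0, deriv (deriv w) t) f (z, w t) := by
  have h1 : deriv (fun s => (z, w s)) =ᶠ[𝓝 t] fun s => ((0 : E), deriv w s) := by
    filter_upwards [eventually_differentiableAt hw] with s hs
    exact deriv_prodMk_const_left z hs
  have h := deriv_deriv_comp_curve (γ := fun s => (z, w s)) hf (contDiffAt_const.prodMk hw)
  rwa [h1.deriv_eq, h1.eq_of_nhds, deriv_prodMk_const_left _ (differentiableAt_deriv hw)] at h

theorem deriv_deriv_left {f : F × E → ℝ} {w : ℝ → F} {t : ℝ} {z : E}
    (hf : ContDiffAt ℝ 2 f (w t, z)) (hw : ContDiffAt ℝ 2 w t) :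
    deriv (deriv fun s => f (w s, z)) t
      = dirQ (deriv w t, 0) (deriv (deriv w) t, 0) f (w t, z) := by
  have h1 : deriv (fun s => (w s, z)) =ᶠ[𝓝 t] fun s => (deriv w s, (0 : E)) := by
    filter_upwards [eventually_differentiableAt hw] with s hs
    exact deriv_prodMk_const_right z hs
  have h := deriv_deriv_comp_curve (γ := fun s => (w s, z)) hf (hw.prodMk contDiffAt_const)
  rwa [h1.deriv_eq, h1.eq_of_nhds, deriv_prodMk_const_right _ (differentiableAt_deriv hw)] at h

theorem deriv_right {f : E × F → ℝ} {w : ℝ → F} {t : ℝ} {z : E}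
    (hf : DifferentiableAt ℝ f (z, w t)) (hw : DifferentiableAt ℝ w t) :
    deriv (fun s => f (z, w s)) t = dirD (0, deriv w t) f (z, w t) := by
  have h := (hasDerivAt_comp_curve (γ := fun s => (z, w s)) hf
    ((differentiableAt_const z).prodMk hw)).deriv
  rwa [deriv_prodMk_const_left z hw] at h

theorem deriv_left {f : F × E → ℝ} {w : ℝ → F} {t : ℝ} {z : E}
    (hf : DifferentiableAt ℝ f (w t, z)) (hw : DifferentiableAt ℝ w t) :
    deriv (fun s => f (w s, z)) t = dirD (deriv w t, 0) f (w t, z) := by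
  have h := (hasDerivAt_comp_curve (γ := fun s => (w s, z)) hf
    (hw.prodMk (differentiableAt_const z))).deriv
  rwa [deriv_prodMk_const_right z hw] at h

theorem deriv_affine (α β t : ℝ) : deriv (fun s : ℝ => α + s * β) t = β := by
  simp

theorem deriv_deriv_affine (α β t : ℝ) : deriv (deriv fun s : ℝ => α + s * β) t = 0 := by
  have : deriv (fun s : ℝ => α + s * β) = fun _ => β := funext fun s => deriv_affine α β s
  rw [this, deriv_const]

theorem deriv_deriv_add {u v : ℝ → ℝ} {t : ℝ} (hu : ContDiffAt ℝ 2 u t) (hv : ContDiffAt ℝ 2 v t) :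
    deriv (deriv fun s => u s + v s) t = deriv (deriv u) t + deriv (deriv v) t := by
  have h : deriv (fun s => u s + v s) =ᶠ[𝓝 t] fun s => deriv u s + deriv v s := by
    filter_upwards [eventually_differentiableAt hu, eventually_differentiableAt hv] with s h1 h2
    exact deriv_fun_add h1 h2
  rw [h.deriv_eq, deriv_fun_add (differentiableAt_deriv hu) (differentiableAt_deriv hv)]

theorem deriv_deriv_neg (u : ℝ → ℝ) (t : ℝ) :
    deriv (deriv fun s => -u s) t = -deriv (deriv u) t := by
  have h : deriv (fun s => -u s) = fun s => -deriv u s := funext fun s => deriv.fun_neg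
  rw [h, deriv.fun_neg]

end ProductCurves

section Arcs

variable {n : ℕ}
  {M : Type*} [TopologicalSpace M] [ChartedSpace (Euc n) M] [IsManifold (𝓡 n) ∞ M]
  {N : Type*} [TopologicalSpace N] [ChartedSpace (Euc n) N] [IsManifold (𝓡 n) ∞ N]
  [Nonempty N]

/-- The `c`-segment `t ↦ c-Exp_x(A + tB)`. -/
def arc (g : RMetric n M) (c : M → N → ℝ) (Λ : Set N) (x : M) (A B : Euc n) (t : ℝ) : N :=
  cE g c Λ x (A + t • B)

/-- The `c`-segment `t ↦ c-Exp_x(A + tB)` in the preferred chart at `y`. -/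
def arcChart (g : RMetric n M) (c : M → N → ℝ) (Λ : Set N) (x : M) (A B : Euc n) (y : N) (t : ℝ) :
    Euc n :=
  extChartAt (𝓡 n) y (arc g c Λ x A B t)

/-- The `c`-sectional curvature as a function on the model space. -/
def curv (g : RMetric n M) (c : M → N → ℝ) (Λ : Set N) (x : M) (y : N) (η ξ : Euc n) : ℝ :=
  cSectionalCurvature g c Λ x y η ξ

theorem CurvatureBound.le_curv {g : RMetric n M} {c : M → N → ℝ} {Ω : Set M} {Λ : Set N} {C₀ : ℝ}
    (hC : CurvatureBound g c Ω Λ C₀) {x : M} (hx : x ∈ Ω) {y : N} (hy : y ∈ Λ) {η ξ : Euc n}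
    (h : metricAt g x η ξ = 0) :
    C₀ * metricAt g x η η * metricAt g x ξ ξ ≤ curv g c Λ x y η ξ :=
  hC x hx y hy η ξ h

namespace Regular

variable {g : RMetric n M} {c : M → N → ℝ} {Ω : Set M} {Λ : Set N} {x : M} {y : N} {A B : Euc n}
  {t₀ : ℝ}

theorem arc_eq (H : Regular g c Ω Λ) (hx : x ∈ Ω) (hy : y ∈ Λ) (hP : A + t₀ • B = mom g c x y) :
    arc g c Λ x A B t₀ = y := by
  rw [arc, hP, H.cE_mom hx hy]

theorem arcChart_eq (H : Regular g c Ω Λ) (hx : x ∈ Ω) (hy : y ∈ Λ)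
    (hP : A + t₀ • B = mom g c x y) : arcChart g c Λ x A B y t₀ = extChartAt (𝓡 n) y y := by
  rw [arcChart, H.arc_eq hx hy hP]

theorem contDiffAt_arcChart (H : Regular g c Ω Λ) (hx : x ∈ Ω) (hy : y ∈ Λ)
    (hP : A + t₀ • B = mom g c x y) : ContDiffAt ℝ 3 (arcChart g c Λ x A B y) t₀ := by
  have h := (H.cE_local hx hy).1
  rw [← hP] at h
  have h2 : ContDiffAt ℝ 3 (fun t : ℝ => A + t • B) t₀ := by fun_prop
  exact ContDiffAt.comp (g := fun p => extChartAt (𝓡 n) y (cE g c Λ x p)) t₀ h h2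

theorem eventually_arc (H : Regular g c Ω Λ) (hx : x ∈ Ω) (hy : y ∈ Λ)
    (hP : A + t₀ • B = mom g c x y) : ∀ᶠ t in 𝓝 t₀, A + t • B ∈ mom g c x '' Λ ∧
      arc g c Λ x A B t ∈ (extChartAt (𝓡 n) y).source := by
  have h := (H.cE_local hx hy).2
  rw [← hP] at h
  have h2 : ContinuousAt (fun t : ℝ => A + t • B) t₀ := by fun_prop
  exact h2.eventually h

theorem eventually_arcChart (H : Regular g c Ω Λ) (hx : x ∈ Ω) (hy : y ∈ Λ)
    (hP : A + t₀ • B = mom g c x y) {p : Euc n → Prop}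
    (hp : ∀ᶠ w in 𝓝 (extChartAt (𝓡 n) y y), p w) :
    ∀ᶠ t in 𝓝 t₀, p (arcChart g c Λ x A B y t) := by
  rw [← H.arcChart_eq hx hy hP] at hp
  exact (H.contDiffAt_arcChart hx hy hP).continuousAt.eventually hp

theorem eventually_symm_arcChart (H : Regular g c Ω Λ) (hx : x ∈ Ω) (hy : y ∈ Λ)
    (hP : A + t₀ • B = mom g c x y) : ∀ᶠ t in 𝓝 t₀,
      (extChartAt (𝓡 n) y).symm (arcChart g c Λ x A B y t) = arc g c Λ x A B t := by
  filter_upwards [H.eventually_arc hx hy hP] with t ht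
  exact (extChartAt (𝓡 n) y).left_inv ht.2

theorem eventually_dirD_arc (H : Regular g c Ω Λ) (hx : x ∈ Ω) (hy : y ∈ Λ)
    (hP : A + t₀ • B = mom g c x y) : ∀ᶠ t in 𝓝 t₀, ∀ u : Euc n,
      dirD (u, 0) (costInChart c x y) (extChartAt (𝓡 n) x x, arcChart g c Λ x A B y t)
        = -metricAt g x A u + t * -metricAt g x B u := by
  filter_upwards [H.eventually_arcChart hx hy hP (H.eventually_metricAt_mom g hx hy),
    H.eventually_arc hx hy hP, H.eventually_symm_arcChart hx hy hP] with t h1 h2 h3 u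
  have h4 := h1 u
  rw [h3, arc, mom_cE h2.1] at h4
  have h5 : metricAt g x (A + t • B) u = metricAt g x A u + t * metricAt g x B u := by simp
  linarith

theorem chartPt_eq (H : Regular g c Ω Λ) (hx : x ∈ Ω) (hy : y ∈ Λ)
    (hP : A + t₀ • B = mom g c x y) :
    (extChartAt (𝓡 n) x x, arcChart g c Λ x A B y t₀) = chartPt n x y := by
  rw [H.arcChart_eq hx hy hP, chartPt]

/-- The velocity of a `c`-segment. -/
theorem dirD_velocity (H : Regular g c Ω Λ) (hx : x ∈ Ω) (hy : y ∈ Λ)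
    (hP : A + t₀ • B = mom g c x y) (u : Euc n) :
    dirD (0, deriv (arcChart g c Λ x A B y) t₀) (dirD (u, 0) (costInChart c x y)) (chartPt n x y)
      = -metricAt g x B u := by
  have hc := contDiffAt_dirD (m := 3) (H.contDiffAt x hx y hy) (by norm_num) (u, 0)
  rw [← H.chartPt_eq hx hy hP] at hc ⊢
  rw [← deriv_right (hc.differentiableAt (by norm_num))
    ((H.contDiffAt_arcChart hx hy hP).differentiableAt (by norm_num))]
  have h : (fun t => dirD (u, 0) (costInChart c x y)
      (extChartAt (𝓡 n) x x, arcChart g c Λ x A B y t)) =ᶠ[𝓝 t₀]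
      fun t => -metricAt g x A u + t * -metricAt g x B u := by
    filter_upwards [H.eventually_dirD_arc hx hy hP] with t ht using ht u
  rw [h.deriv_eq, deriv_affine]

/-- Along a `c`-segment the covector `∂_x c` is affine in the parameter. -/
theorem dirQ_acceleration (H : Regular g c Ω Λ) (hx : x ∈ Ω) (hy : y ∈ Λ)
    (hP : A + t₀ • B = mom g c x y) (u : Euc n) :
    dirQ (0, deriv (arcChart g c Λ x A B y) t₀) (0, deriv (deriv (arcChart g c Λ x A B y)) t₀)
      (dirD (u, 0) (costInChart c x y)) (chartPt n x y) = 0 := by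
  have hc := contDiffAt_dirD (m := 2) (H.contDiffAt x hx y hy) (by norm_num) (u, 0)
  rw [← H.chartPt_eq hx hy hP] at hc ⊢
  rw [← deriv_deriv_right hc ((H.contDiffAt_arcChart hx hy hP).of_le (by norm_num))]
  have h : (fun t => dirD (u, 0) (costInChart c x y)
      (extChartAt (𝓡 n) x x, arcChart g c Λ x A B y t)) =ᶠ[𝓝 t₀]
      fun t => -metricAt g x A u + t * -metricAt g x B u := by
    filter_upwards [H.eventually_dirD_arc hx hy hP] with t ht using ht u
  rw [h.deriv.deriv_eq, deriv_deriv_affine]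

theorem velocity_ne_zero (H : Regular g c Ω Λ) (hx : x ∈ Ω) (hy : y ∈ Λ)
    (hP : A + t₀ • B = mom g c x y) (hB : B ≠ 0) : deriv (arcChart g c Λ x A B y) t₀ ≠ 0 := by
  intro h0
  have h := H.dirD_velocity hx hy hP B
  rw [h0] at h
  have h1 : dirD (0, (0 : Euc n)) (dirD (B, 0) (costInChart c x y)) (chartPt n x y) = 0 :=
    map_zero (fderiv ℝ (dirD (B, 0) (costInChart c x y)) (chartPt n x y))
  have := metricAt_pos g x hB
  linarith

/-- Nondegeneracy: the velocity of a `c`-segment is determined by the covector `B`. -/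
theorem velocity_unique (H : Regular g c Ω Λ) (hx : x ∈ Ω) (hy : y ∈ Λ)
    (hP : A + t₀ • B = mom g c x y) {v : Euc n}
    (hv : ∀ u : Euc n, dirD (0, v) (dirD (u, 0) (costInChart c x y)) (chartPt n x y)
      = -metricAt g x B u) : deriv (arcChart g c Λ x A B y) t₀ = v := by
  refine sub_eq_zero.1 (H.nondeg x hx y hy _ fun u => ?_)
  have h1 := H.dirD_velocity hx hy hP u
  have h2 := hv u
  simp only [dirD] at h1 h2 ⊢
  rw [show ((0 : Euc n), deriv (arcChart g c Λ x A B y) t₀ - v)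
    = (0, deriv (arcChart g c Λ x A B y) t₀) - (0, v) by simp, map_sub, h1, h2, sub_self]

/-- The `c`-sectional curvature as a fourth derivative of the cost in charts. -/
theorem curv_eq (H : Regular g c Ω Λ) (hx : x ∈ Ω) (hy : y ∈ Λ) (η ξ : Euc n) :
    curv g c Λ x y η ξ
      = -dirQ (0, deriv (arcChart g c Λ x (mom g c x y) ξ y) 0)
          (0, deriv (deriv (arcChart g c Λ x (mom g c x y) ξ y)) 0)
          (dirD (η, 0) (dirD (η, 0) (costInChart c x y))) (chartPt n x y) := by
  set A := mom g c x y with hA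
  have hP : A + (0 : ℝ) • ξ = mom g c x y := by simp [hA]
  let Γ : Euc n := christoffel g x η η
  let φ := extChartAt (𝓡 n) x
  have hev : (fun t : ℝ => -hess g (fun x' => c x' (arc g c Λ x A ξ t)) x η η)
      =ᶠ[𝓝 0] fun t => -dirD (η, 0) (dirD (η, 0) (costInChart c x y)) (φ x, arcChart g c Λ x A ξ y t)
        + (-metricAt g x A Γ + t * -metricAt g x ξ Γ) := by
    filter_upwards [H.eventually_arc hx hy hP, H.eventually_symm_arcChart hx hy hP,
      H.eventually_arcChart hx hy hP (H.eventually_contDiffAt_right hx hy)] with t h1 h2 h3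
    set w := arcChart g c Λ x A ξ y t with hw
    have e2 : hess g (fun x' => c x' (arc g c Λ x A ξ t)) x η η
        = fderiv ℝ (fderiv ℝ (fun z => costInChart c x y (z, w))) (φ x) η η
          + metricAt g x (A + t • ξ) Γ := by
      have e3 := metricAt_mom_mfderiv g c x (cE g c Λ x (A + t • ξ)) Γ
      rw [mom_cE h1.1] at e3
      rw [e3]
      have e4 : (fun z => costInChart c x y (z, w))
          = (fun x' => c x' (arc g c Λ x A ξ t)) ∘ φ.symm := by
        funext z
        simp only [costInChart, Function.comp]
        rw [h2]
      rw [e4]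
      exact sub_eq_add_neg _ _
    have h4 : ContDiffAt ℝ 4 (fun z => costInChart c x y (z, w)) (φ x) :=
      ContDiffAt.comp (g := costInChart c x y) (φ x) h3 (contDiffAt_id.prodMk contDiffAt_const)
    have e5 : fderiv ℝ (fderiv ℝ (fun z => costInChart c x y (z, w))) (φ x) η η
        = dirD (η, 0) (dirD (η, 0) (costInChart c x y)) (φ x, w) := by
      rw [← dirD_dirD (h4.of_le (by norm_num))]
      have h5 : dirD η (fun z => costInChart c x y (z, w)) =ᶠ[𝓝 (φ x)]
          fun z => dirD (η, 0) (costInChart c x y) (z, w) := by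
        have hcont : ContinuousAt (fun z : Euc n => (z, w)) (φ x) := by fun_prop
        filter_upwards [hcont.eventually (eventually_contDiffAt (k := 4) h3)] with z hz
        exact dirD_comp_prodMk_left (hz.differentiableAt (by norm_num)) η
      rw [(dirD_congr h5 η).eq_of_nhds]
      exact dirD_comp_prodMk_left ((contDiffAt_dirD (m := 3) h3 (by norm_num)
        (η, 0)).differentiableAt (by norm_num)) η
    rw [e2, e5]
    have h6 : metricAt g x (A + t • ξ) Γ = metricAt g x A Γ + t * metricAt g x ξ Γ := by simp
    rw [h6]
    ring
  have hc := contDiffAt_dirD (m := 2) (contDiffAt_dirD (m := 3) (H.contDiffAt x hx y hy)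
    (by norm_num) (η, 0)) (by norm_num) (η, 0)
  rw [← H.chartPt_eq hx hy hP] at hc ⊢
  have hw : ContDiffAt ℝ 2 (arcChart g c Λ x A ξ y) 0 :=
    (H.contDiffAt_arcChart hx hy hP).of_le (by norm_num)
  have hcw : ContDiffAt ℝ 2 (fun t => dirD (η, 0) (dirD (η, 0) (costInChart c x y))
      (φ x, arcChart g c Λ x A ξ y t)) 0 :=
    ContDiffAt.comp (g := dirD (η, 0) (dirD (η, 0) (costInChart c x y))) 0 hc
      (contDiffAt_const.prodMk hw)
  have hS : curv g c Λ x y η ξ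
      = iteratedDeriv 2 (fun t => -hess g (fun x' => c x' (arc g c Λ x A ξ t)) x η η) 0 := rfl
  rw [hS, iteratedDeriv_succ, iteratedDeriv_one, hev.deriv.deriv_eq,
    deriv_deriv_add hcw.neg (by fun_prop), deriv_deriv_affine, add_zero, deriv_deriv_neg,
    deriv_deriv_right hc hw]

end Regular

end Arcs

section Calculus

theorem dirD_comp_swap {V W : Type*} [NormedAddCommGroup V] [NormedSpace ℝ V]
    [NormedAddCommGroup W] [NormedSpace ℝ W] (f : V × W → ℝ) (a : W × V) :
    dirD a (f ∘ Prod.swap) = dirD a.swap f ∘ Prod.swap := by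
  funext p
  have h := (ContinuousLinearEquiv.prodComm ℝ W V).comp_right_fderiv (f := f) (x := p)
  have h' : fderiv ℝ (f ∘ Prod.swap) p = _ := h
  simp only [dirD, h']
  rfl

theorem dirQ_comp_swap {V W : Type*} [NormedAddCommGroup V] [NormedSpace ℝ V]
    [NormedAddCommGroup W] [NormedSpace ℝ W] (f : V × W → ℝ) (a a' : W × V) :
    dirQ a a' (f ∘ Prod.swap) = dirQ a.swap a'.swap f ∘ Prod.swap := by
  funext p
  simp only [dirQ, dirD_comp_swap, Function.comp]

/-- The accelerations do not contribute to the cross derivative when the first derivatives of `f`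
are affine along the curves. -/
theorem dirQ_dirQ_eq {V : Type*} [NormedAddCommGroup V] [NormedSpace ℝ V] {f : V → ℝ} {p : V}
    (hf : ContDiffAt ℝ 4 f p) {a a' b b' b'' : V} (h1 : dirQ a a' (dirD b' f) p = 0)
    (h2 : dirQ a a' (dirD b'' f) p = 0) (h3 : dirQ b b'' (dirD a' f) p = 0) :
    dirQ a a' (dirQ b b' f) p = dirQ b b'' (dirD a (dirD a f)) p := by
  have key : ∀ a a' b b' : V, dirQ a a' (dirQ b b' f) p
      = dirQ a a' (dirD b (dirD b f)) p + dirQ a a' (dirD b' f) p := fun a a' b b' =>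
    dirQ_add (contDiffAt_dirD (contDiffAt_dirD (m := 3) hf (by norm_num) b) (by norm_num) b)
      (contDiffAt_dirD hf (by norm_num) b') a a'
  have e1 := key a a' b b'
  have e2 := key a a' b b''
  have e3 := key b b'' a a'
  have e4 := dirQ_comm hf a a' b b''
  linarith

theorem le_of_second_deriv_nonpos {E : ℝ → ℝ} (hE : ∀ s ∈ Icc (0 : ℝ) 1, ContDiffAt ℝ 2 E s)
    (h0 : deriv E 0 = 0) (h2 : ∀ s ∈ Icc (0 : ℝ) 1, deriv (deriv E) s ≤ 0) : E 1 ≤ E 0 := by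
  have hd : AntitoneOn (deriv E) (Icc 0 1) :=
    antitoneOn_of_deriv_nonpos (convex_Icc 0 1)
      (fun s hs => (differentiableAt_deriv (hE s hs)).continuousAt.continuousWithinAt)
      (fun s hs => (differentiableAt_deriv (hE s (interior_subset hs))).differentiableWithinAt)
      (fun s hs => h2 s (interior_subset hs))
  have h : AntitoneOn E (Icc 0 1) :=
    antitoneOn_of_deriv_nonpos (convex_Icc 0 1)
      (fun s hs => (hE s hs).continuousAt.continuousWithinAt)
      (fun s hs => ((hE s (interior_subset hs)).differentiableAt
        (by norm_num)).differentiableWithinAt)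
      (fun s hs => by
        have hs' := interior_subset hs
        exact (hd (by simp) hs' hs'.1).trans h0.le)
  exact h (by simp) (by simp) zero_le_one

theorem lt_of_second_deriv_neg {E : ℝ → ℝ} (hE : ∀ s ∈ Icc (0 : ℝ) 1, ContDiffAt ℝ 2 E s)
    (h0 : deriv E 0 = 0) (h2 : ∀ s ∈ Icc (0 : ℝ) 1, deriv (deriv E) s < 0) : E 1 < E 0 := by
  have hd : StrictAntiOn (deriv E) (Icc 0 1) :=
    strictAntiOn_of_deriv_neg (convex_Icc 0 1)
      (fun s hs => (differentiableAt_deriv (hE s hs)).continuousAt.continuousWithinAt)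
      (fun s hs => h2 s (interior_subset hs))
  have h : StrictAntiOn E (Icc 0 1) :=
    strictAntiOn_of_deriv_neg (convex_Icc 0 1)
      (fun s hs => (hE s hs).continuousAt.continuousWithinAt)
      (fun s hs => by
        have hs' := interior_subset hs
        rw [interior_Icc] at hs
        exact (hd (by simp) hs' hs.1).trans_eq h0)
  exact h (by simp) (by simp) zero_lt_one

end Calculus

section NullInequality

variable {n : ℕ}
  {M : Type*} [TopologicalSpace M] [ChartedSpace (Euc n) M] [IsManifold (𝓡 n) ∞ M] [Nonempty M]
  {N : Type*} [TopologicalSpace N] [ChartedSpace (Euc n) N] [IsManifold (𝓡 n) ∞ N] [Nonempty N]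

namespace Regular

variable {g : RMetric n M} {h : RMetric n N} {c : M → N → ℝ} {Ω : Set M} {Λ : Set N} {xm : M}
  {y : N} {A B : Euc n} {θ : ℝ}

/-- The first two derivatives of the cost along a `c`-segment, near `x`, in charts. -/
theorem eventually_deriv_cost_arc (H : Regular g c Ω Λ) (hxm : xm ∈ Ω) (hy : y ∈ Λ)
    (hP : A + θ • B = mom g c xm y) {x : M} (hx : x ∈ Ω) :
    ∀ᶠ z in 𝓝 (extChartAt (𝓡 n) x x),
      deriv (fun t => c ((extChartAt (𝓡 n) x).symm z) (arc g c Λ xm A B t)) θ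
        = dirD (0, deriv (arcChart g c Λ xm A B y) θ) (costInChart c x y)
          (z, extChartAt (𝓡 n) y y) ∧
      deriv (deriv fun t => c ((extChartAt (𝓡 n) x).symm z) (arc g c Λ xm A B t)) θ
        = dirQ (0, deriv (arcChart g c Λ xm A B y) θ) (0, deriv (deriv (arcChart g c Λ xm A B y)) θ)
          (costInChart c x y) (z, extChartAt (𝓡 n) y y) := by
  have hcont : ContinuousAt (fun z : Euc n => (z, extChartAt (𝓡 n) y y)) (extChartAt (𝓡 n) x x) := by
    fun_prop
  filter_upwards [hcont.eventually (eventually_contDiffAt (k := 4) (H.contDiffAt x hx y hy))]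
    with z hz
  have he : (fun t => c ((extChartAt (𝓡 n) x).symm z) (arc g c Λ xm A B t)) =ᶠ[𝓝 θ]
      fun t => costInChart c x y (z, arcChart g c Λ xm A B y t) := by
    filter_upwards [H.eventually_symm_arcChart hxm hy hP] with t ht
    simp only [costInChart]
    rw [ht]
  have hw := H.contDiffAt_arcChart hxm hy hP
  rw [← H.arcChart_eq hxm hy hP] at hz ⊢
  rw [he.deriv_eq, he.deriv.deriv_eq]
  exact ⟨deriv_right (hz.differentiableAt (by norm_num)) (hw.differentiableAt (by norm_num)),
    deriv_deriv_right (hz.of_le (by norm_num)) (hw.of_le (by norm_num))⟩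

/-- Loeper's inequality: where the first derivative of the sliding mountain vanishes, its second
derivative is nonnegative. -/
theorem second_deriv_mountain (H : Regular g c Ω Λ) (H' : Regular h (fun y x => c x y) Λ Ω)
    {C₀ : ℝ} (hC₀ : 0 ≤ C₀) (hcurv : CurvatureBound g c Ω Λ C₀) (hxm : xm ∈ Ω) (hy : y ∈ Λ)
    (hP : A + θ • B = mom g c xm y) {x : M} (hx : x ∈ Ω)
    (hzero : deriv (fun t => c x (arc g c Λ xm A B t)) θ
      = deriv (fun t => c xm (arc g c Λ xm A B t)) θ) :
    deriv (deriv fun t => c x (arc g c Λ xm A B t)) θ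
      ≤ deriv (deriv fun t => c xm (arc g c Λ xm A B t)) θ ∧
    (0 < C₀ → x ≠ xm → B ≠ 0 → deriv (deriv fun t => c x (arc g c Λ xm A B t)) θ
      < deriv (deriv fun t => c xm (arc g c Λ xm A B t)) θ) := by
  set w := arcChart g c Λ xm A B y with hw
  set b := deriv w θ with hb
  set b' := deriv (deriv w) θ with hb'
  set A' := mom h (fun y x => c x y) y xm with hA'
  set B' := mom h (fun y x => c x y) y x - A' with hB'
  set X := arc h (fun y x => c x y) Ω y A' B' with hX
  set E₁ : ℝ → ℝ := fun s => deriv (fun t => c (X s) (arc g c Λ xm A B t)) θ with hE₁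
  set E₂ : ℝ → ℝ := fun s => deriv (deriv fun t => c (X s) (arc g c Λ xm A B t)) θ with hE₂
  have hmem : ∀ s ∈ Icc (0 : ℝ) 1, A' + s • B' ∈ mom h (fun y x => c x y) y '' Ω := fun s hs => by
    have hc := H'.convex y hy (mem_image_of_mem _ hxm) (mem_image_of_mem _ hx)
      (sub_nonneg.2 hs.2) hs.1 (by ring)
    convert hc using 1
    rw [hB', hA']
    module
  have hXs : ∀ s ∈ Icc (0 : ℝ) 1, X s ∈ Ω ∧ A' + s • B' = mom h (fun y x => c x y) y (X s) :=
    fun s hs => ⟨cE_mem (hmem s hs), (mom_cE (hmem s hs)).symm⟩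
  have hX0 : X 0 = xm := H'.arc_eq hy hxm (by simp [hA'])
  have hX1 : X 1 = x := H'.arc_eq hy hx (by simp [hB'])
  have hloc : ∀ s₀ ∈ Icc (0 : ℝ) 1, ∀ᶠ s in 𝓝 s₀,
      E₁ s = dirD (0, b) (costInChart c (X s₀) y)
        (arcChart h (fun y x => c x y) Ω y A' B' (X s₀) s, extChartAt (𝓡 n) y y) ∧
      E₂ s = dirQ (0, b) (0, b') (costInChart c (X s₀) y)
        (arcChart h (fun y x => c x y) Ω y A' B' (X s₀) s, extChartAt (𝓡 n) y y) := by
    intro s₀ hs₀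
    obtain ⟨hx₀, hP'⟩ := hXs s₀ hs₀
    filter_upwards [H'.eventually_arcChart hy hx₀ hP' (H.eventually_deriv_cost_arc hxm hy hP hx₀),
      H'.eventually_symm_arcChart hy hx₀ hP'] with s h1 h2
    rw [h2] at h1
    exact h1
  have hE₁aff : ∀ s ∈ Icc (0 : ℝ) 1, E₁ s = -metricAt h y A' b + s * -metricAt h y B' b := by
    intro s hs
    obtain ⟨hx₀, hP'⟩ := hXs s hs
    have h1 := (H'.eventually_dirD_arc hy hx₀ hP').self_of_nhds b
    rw [costInChart_swap, dirD_comp_swap] at h1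
    rw [(hloc s hs).self_of_nhds.1]
    exact h1
  have hnull : metricAt h y B' b = 0 := by
    have h0 := hE₁aff 0 (by simp)
    have h1 := hE₁aff 1 (by simp)
    have h2 : E₁ 1 = E₁ 0 := by simp only [hE₁, hX0, hX1]; exact hzero
    linarith
  have hE₂s : ∀ s ∈ Icc (0 : ℝ) 1, ContDiffAt ℝ 2 E₂ s := by
    intro s hs
    obtain ⟨hx₀, hP'⟩ := hXs s hs
    have h1 : ContDiffAt ℝ 2 (dirQ (0, b) (0, b') (costInChart c (X s) y)) (chartPt n (X s) y) :=
      contDiffAt_dirQ (H.contDiffAt (X s) hx₀ y hy) (by norm_num) _ _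
    rw [chartPt, ← H'.arcChart_eq hy hx₀ hP'] at h1
    have h2 := (H'.contDiffAt_arcChart hy hx₀ hP').of_le (m := 2) (by norm_num)
    refine ContDiffAt.congr_of_eventuallyEq (ContDiffAt.comp
      (g := dirQ (0, b) (0, b') (costInChart c (X s) y)) s h1 (h2.prodMk contDiffAt_const)) ?_
    filter_upwards [hloc s hs] with s' hs' using hs'.2
  have hE₂0 : deriv E₂ 0 = 0 := by
    have h0 : (0 : ℝ) ∈ Icc (0 : ℝ) 1 := by simp
    obtain ⟨hx₀, hP'⟩ := hXs 0 h0
    have he : E₂ =ᶠ[𝓝 0] fun s => dirQ (0, b) (0, b') (costInChart c (X 0) y)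
        (arcChart h (fun y x => c x y) Ω y A' B' (X 0) s, extChartAt (𝓡 n) y y) := by
      filter_upwards [hloc 0 h0] with s' hs' using hs'.2
    have hc := H.contDiffAt (X 0) hx₀ y hy
    have h1 : ContDiffAt ℝ 2 (dirQ (0, b) (0, b') (costInChart c (X 0) y)) (chartPt n (X 0) y) :=
      contDiffAt_dirQ hc (by norm_num) _ _
    rw [chartPt, ← H'.arcChart_eq hy hx₀ hP'] at h1
    rw [he.deriv_eq, deriv_left (h1.differentiableAt (by norm_num))
      ((H'.contDiffAt_arcChart hy hx₀ hP').differentiableAt (by norm_num)),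
      H'.arcChart_eq hy hx₀ hP']
    change dirD _ _ (chartPt n (X 0) y) = 0
    rw [← dirQ_dirD_comm (hc.of_le (by norm_num)), hX0]
    exact H.dirQ_acceleration hxm hy hP _
  have hE₂2 : ∀ s ∈ Icc (0 : ℝ) 1, ∃ ξ : Euc n, (B ≠ 0 → ξ ≠ 0) ∧
      metricAt g (X s) (deriv (arcChart h (fun y x => c x y) Ω y A' B' (X s)) s) ξ = 0 ∧
      deriv (deriv E₂) s = -curv g c Λ (X s) y
        (deriv (arcChart h (fun y x => c x y) Ω y A' B' (X s)) s) ξ := by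
    intro s hs
    obtain ⟨hx₀, hP'⟩ := hXs s hs
    set x₀ := X s with hx₀'
    set Z := arcChart h (fun y x => c x y) Ω y A' B' x₀ with hZ
    set a := deriv Z s with ha
    set f : Euc n × Euc n → ℝ := costInChart c x₀ y with hf
    have hc : ContDiffAt ℝ 4 f (chartPt n x₀ y) := H.contDiffAt x₀ hx₀ y hy
    have hc2 : ContDiffAt ℝ 2 f (chartPt n x₀ y) := hc.of_le (by norm_num)
    obtain ⟨ξ, hξ⟩ := metricAt_surjective g x₀ (-((fderiv ℝ (fderiv ℝ f) (chartPt n x₀ y) (0, b)).comp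
      (ContinuousLinearMap.inl ℝ (Euc n) (Euc n))))
    have hξu : ∀ u : Euc n, dirD (0, b) (dirD (u, 0) f) (chartPt n x₀ y) = -metricAt g x₀ ξ u := by
      intro u
      rw [hξ, dirD_dirD hc2]
      simp
    refine ⟨ξ, fun hB hξ0 => ?_, ?_, ?_⟩
    · refine H.velocity_ne_zero hxm hy hP hB (H.nondeg x₀ hx₀ y hy b fun u => ?_)
      rw [hξu, hξ0]
      simp
    · have h1 := H'.dirD_velocity hy hx₀ hP' b
      rw [costInChart_swap, dirD_comp_swap, dirD_comp_swap] at h1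
      have h2 : dirD (a, 0) (dirD (0, b) f) (chartPt n x₀ y) = -metricAt h y B' b := h1
      rw [dirD_comm hc2, hξu a, hnull] at h2
      rw [metricAt_symm]
      linarith
    · have hv := H.velocity_unique (A := mom g c x₀ y) (B := ξ) (t₀ := 0) hx₀ hy (by simp) hξu
      rw [H.curv_eq hx₀ hy, hv, neg_neg]
      have he : E₂ =ᶠ[𝓝 s] fun s' => dirQ (0, b) (0, b') f (Z s', extChartAt (𝓡 n) y y) := by
        filter_upwards [hloc s hs] with s' hs' using hs'.2
      have h1 : ContDiffAt ℝ 2 (dirQ (0, b) (0, b') f) (chartPt n x₀ y) :=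
        contDiffAt_dirQ hc (by norm_num) _ _
      rw [chartPt, ← H'.arcChart_eq hy hx₀ hP'] at h1
      rw [he.deriv.deriv_eq, deriv_deriv_left h1
        ((H'.contDiffAt_arcChart hy hx₀ hP').of_le (by norm_num)), H'.arcChart_eq hy hx₀ hP']
      have h2 : ∀ u : Euc n, dirQ (a, 0) (deriv (deriv Z) s, 0) (dirD (0, u) f) (chartPt n x₀ y)
          = 0 := fun u => by
        have h3 := H'.dirQ_acceleration hy hx₀ hP' u
        rw [costInChart_swap, dirD_comp_swap, dirQ_comp_swap] at h3
        exact h3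
      have h4 := H.dirQ_acceleration (A := mom g c x₀ y) (B := ξ) (t₀ := 0) hx₀ hy (by simp)
        (deriv (deriv Z) s)
      rw [hv] at h4
      exact dirQ_dirQ_eq hc (h2 _) (h2 _) h4
  have hfin : E₂ 1 = deriv (deriv fun t => c x (arc g c Λ xm A B t)) θ := by simp only [hE₂, hX1]
  have hfin0 : E₂ 0 = deriv (deriv fun t => c xm (arc g c Λ xm A B t)) θ := by simp only [hE₂, hX0]
  rw [← hfin, ← hfin0]
  have hnonneg : ∀ (x : M) (u : Euc n), 0 ≤ metricAt g x u u := fun x u => by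
    by_cases hu : u = 0
    · simp [hu]
    · exact (metricAt_pos g x hu).le
  constructor
  · refine le_of_second_deriv_nonpos hE₂s hE₂0 fun s hs => ?_
    obtain ⟨ξ, -, h1, h2⟩ := hE₂2 s hs
    have h3 := hcurv.le_curv (hXs s hs).1 hy h1
    have h4 := mul_nonneg (mul_nonneg hC₀ (hnonneg (X s)
      (deriv (arcChart h (fun y x => c x y) Ω y A' B' (X s)) s))) (hnonneg (X s) ξ)
    have h5 := h4.trans h3
    linarith
  · intro hC hne hB
    refine lt_of_second_deriv_neg hE₂s hE₂0 fun s hs => ?_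
    obtain ⟨ξ, hξ, h1, h2⟩ := hE₂2 s hs
    have hB'0 : B' ≠ 0 := fun h0 => hne (H'.injOn y hy hx hxm (sub_eq_zero.1 h0))
    have h3 := hcurv.le_curv (hXs s hs).1 hy h1
    have h4 := mul_pos (mul_pos hC (metricAt_pos g (X s)
      (H'.velocity_ne_zero hy (hXs s hs).1 (hXs s hs).2 hB'0))) (metricAt_pos g (X s) (hξ hB))
    have h5 := h4.trans_le h3
    linarith

end Regular

end NullInequality

section RealLemmas

theorem eventually_pos_right {k : ℝ → ℝ} {x d : ℝ} (hk : HasDerivAt k d x) (hd : 0 < d)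
    (h0 : k x = 0) : ∀ᶠ y in 𝓝[>] x, 0 < k y := by
  have h1 := (hasDerivAt_iff_tendsto_slope.1 hk).eventually (eventually_gt_nhds hd)
  have h2 : 𝓝[>] x ≤ 𝓝[≠] x := nhdsWithin_mono x fun y (hy : x < y) => hy.ne'
  filter_upwards [h2 h1, self_mem_nhdsWithin] with y hy hxy
  rw [slope_def_field, h0, sub_zero] at hy
  exact (div_pos_iff_of_pos_right (sub_pos.2 hxy)).1 hy

theorem eventually_neg_left {k : ℝ → ℝ} {x d : ℝ} (hk : HasDerivAt k d x) (hd : 0 < d)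
    (h0 : k x = 0) : ∀ᶠ y in 𝓝[<] x, k y < 0 := by
  have h1 := (hasDerivAt_iff_tendsto_slope.1 hk).eventually (eventually_gt_nhds hd)
  have h2 : 𝓝[<] x ≤ 𝓝[≠] x := nhdsWithin_mono x fun y (hy : y < x) => hy.ne
  filter_upwards [h2 h1, self_mem_nhdsWithin] with y hy hxy
  rw [slope_def_field, h0, sub_zero] at hy
  by_contra hneg
  exact absurd hy (not_lt.2 (div_nonpos_of_nonneg_of_nonpos (not_lt.1 hneg) (sub_neg.2 hxy).le))

/-- A continuous function which is nonnegative at `a`, and nonnegative on the right of each of its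
zeros, is nonnegative on `[a, b]`. -/
theorem nonneg_of_right_of_zeros {k : ℝ → ℝ} {a b : ℝ} (hk : ∀ θ ∈ Icc a b, ContinuousAt k θ)
    (ha : 0 ≤ k a) (h0 : ∀ θ ∈ Ico a b, k θ = 0 → ∀ᶠ t in 𝓝[>] θ, 0 ≤ k t) :
    ∀ θ ∈ Icc a b, 0 ≤ k θ := by
  have hcl : IsClosed ({θ | 0 ≤ k θ} ∩ Icc a b) := by
    rw [inter_comm]
    exact ContinuousOn.preimage_isClosed_of_isClosed (fun θ hθ => (hk θ hθ).continuousWithinAt)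
      isClosed_Icc isClosed_Ici
  refine hcl.Icc_subset_of_forall_mem_nhdsWithin ha fun θ hθ => ?_
  rcases (show 0 ≤ k θ from hθ.1).eq_or_lt with h | h
  · exact h0 θ hθ.2 h.symm
  · have := ((hk θ (Ico_subset_Icc_self hθ.2)).eventually (eventually_gt_nhds h)).filter_mono
      (nhdsWithin_le_nhds (s := Ioi θ))
    filter_upwards [this] with t ht using ht.le

/-- Suppose that `H(θ, r)` is increasing in `r`, and nondecreasing in `θ` at its zeros. Then
`H(·, 0)` is nonnegative on the right of its zero `a`. -/
theorem eventually_nonneg_of_family {H : ℝ × ℝ → ℝ} {a : ℝ} (hH : ContDiffAt ℝ 1 H (a, 0))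
    (h0 : H (a, 0) = 0) (hr : 0 < dirD (0, 1) H (a, 0))
    (hθ : ∀ᶠ p in 𝓝 (a, (0 : ℝ)), a ≤ p.1 → H p = 0 → 0 ≤ dirD (1, 0) H p) :
    ∀ᶠ θ in 𝓝[>] a, 0 ≤ H (θ, 0) := by
  have hr' : ∀ᶠ p in 𝓝 (a, (0 : ℝ)), 0 < dirD (0, 1) H p :=
    (contDiffAt_dirD (m := 0) hH (by norm_num) (0, 1)).continuousAt.eventually (eventually_gt_nhds hr)
  obtain ⟨ε, hε, hball⟩ := Metric.eventually_nhds_iff.1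
    ((hθ.and hr').and (eventually_contDiffAt (k := 1) hH))
  have hin : ∀ θ r : ℝ, |θ - a| < ε → |r| < ε → dist (θ, r) (a, (0 : ℝ)) < ε := fun θ r h1 h2 => by
    rw [Prod.dist_eq, max_lt_iff, Real.dist_eq, Real.dist_eq, sub_zero]
    exact ⟨h1, h2⟩
  filter_upwards [Ioo_mem_nhdsGT (show a < a + ε by linarith)] with θ₁ hθ₁
  have hκ : ∀ κ ∈ Ioo (0 : ℝ) 1, 0 ≤ H (θ₁, κ * (θ₁ - a)) := by
    intro κ hκ
    have hmem : ∀ θ ∈ Icc a θ₁, dist (θ, κ * (θ - a)) (a, (0 : ℝ)) < ε := by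
      intro θ hθ
      have h1 : 0 ≤ θ - a := sub_nonneg.2 hθ.1
      have h2 : θ - a < ε := by linarith [hθ.2, hθ₁.2]
      refine hin _ _ (by rwa [abs_of_nonneg h1]) ?_
      rw [abs_of_nonneg (mul_nonneg hκ.1.le h1)]
      nlinarith [hκ.2]
    have hd : ∀ θ ∈ Icc a θ₁, HasDerivAt (fun t => H (t, κ * (t - a)))
        (dirD (1, 0) H (θ, κ * (θ - a)) + κ * dirD (0, 1) H (θ, κ * (θ - a))) θ := by
      intro θ hθ
      have h1 : HasDerivAt (fun t : ℝ => (t, κ * (t - a))) ((1 : ℝ), κ) θ := by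
        have h2 := (((hasDerivAt_id θ).sub_const a).const_mul κ)
        rw [mul_one] at h2
        exact (hasDerivAt_id θ).prodMk h2
      have h3 := ((hball (hmem θ hθ)).2.differentiableAt one_ne_zero).hasFDerivAt.comp_hasDerivAt θ h1
      have h4 : ((1 : ℝ), κ) = (1, 0) + κ • ((0 : ℝ), (1 : ℝ)) := by simp
      rw [h4, map_add, map_smul] at h3
      exact h3
    refine nonneg_of_right_of_zeros (k := fun t => H (t, κ * (t - a))) (a := a) (b := θ₁)
      (fun θ hθ => (hd θ hθ).continuousAt) (by simp [h0]) (fun θ hθ hz => ?_) θ₁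
      ⟨hθ₁.1.le, le_rfl⟩
    have hθ' := Ico_subset_Icc_self hθ
    obtain ⟨⟨h1, h2⟩, -⟩ := hball (hmem θ hθ')
    have h3 := h1 hθ.1 hz
    have h4 := mul_pos hκ.1 h2
    filter_upwards [eventually_pos_right (hd θ hθ') (by linarith) hz] with t ht using ht.le
  have hcont : ContinuousAt H (θ₁, 0) := by
    refine (hball (hin θ₁ 0 ?_ (by simpa using hε))).2.continuousAt
    rw [abs_of_pos (sub_pos.2 hθ₁.1)]
    linarith [hθ₁.2]
  have hlim : Tendsto (fun κ : ℝ => H (θ₁, κ * (θ₁ - a))) (𝓝[>] 0) (𝓝 (H (θ₁, 0))) := by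
    have h1 : Tendsto (fun κ : ℝ => (θ₁, κ * (θ₁ - a))) (𝓝 0) (𝓝 (θ₁, 0)) := by
      have h2 : Continuous fun κ : ℝ => (θ₁, κ * (θ₁ - a)) := by fun_prop
      simpa using h2.tendsto 0
    exact (hcont.tendsto.comp h1).mono_left nhdsWithin_le_nhds
  refine ge_of_tendsto hlim ?_
  filter_upwards [Ioo_mem_nhdsGT (show (0 : ℝ) < 1 by norm_num)] with κ hκ' using hκ κ hκ'

end RealLemmas

section Mountain

variable {n : ℕ}
  {M : Type*} [TopologicalSpace M] [ChartedSpace (Euc n) M] [IsManifold (𝓡 n) ∞ M] [Nonempty M]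
  {N : Type*} [TopologicalSpace N] [ChartedSpace (Euc n) N] [IsManifold (𝓡 n) ∞ N] [Nonempty N]

/-- The sliding mountain along the `c`-segment `θ ↦ c-Exp_{x_m}(A + θB)`. -/
def mountain (g : RMetric n M) (c : M → N → ℝ) (Λ : Set N) (xm : M) (A B : Euc n) (x : M) (t : ℝ) :
    ℝ :=
  -c x (arc g c Λ xm A B t) + c xm (arc g c Λ xm A B t)

namespace Regular

variable {g : RMetric n M} {h : RMetric n N} {c : M → N → ℝ} {Ω : Set M} {Λ : Set N} {xm : M}
  {y : N} {A B : Euc n} {θ : ℝ}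

theorem contDiffAt_cost_arc (H : Regular g c Ω Λ) (hxm : xm ∈ Ω) (hy : y ∈ Λ)
    (hP : A + θ • B = mom g c xm y) {x : M} (hx : x ∈ Ω) :
    ContDiffAt ℝ 3 (fun t => c x (arc g c Λ xm A B t)) θ := by
  have hc : ContDiffAt ℝ 3 (costInChart c x y) (chartPt n x y) :=
    (H.contDiffAt x hx y hy).of_le (by norm_num)
  rw [chartPt, ← H.arcChart_eq hxm hy hP] at hc
  refine ContDiffAt.congr_of_eventuallyEq (ContDiffAt.comp (g := costInChart c x y) θ hc
    (contDiffAt_const.prodMk (H.contDiffAt_arcChart hxm hy hP))) ?_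
  filter_upwards [H.eventually_symm_arcChart hxm hy hP] with t ht
  simp only [costInChart, Function.comp, extChartAt_to_inv]
  rw [ht]

theorem contDiffAt_mountain (H : Regular g c Ω Λ) (hxm : xm ∈ Ω) (hy : y ∈ Λ)
    (hP : A + θ • B = mom g c xm y) {x : M} (hx : x ∈ Ω) :
    ContDiffAt ℝ 3 (mountain g c Λ xm A B x) θ :=
  (H.contDiffAt_cost_arc hxm hy hP hx).neg.add (H.contDiffAt_cost_arc hxm hy hP hxm)

theorem deriv_deriv_mountain (H : Regular g c Ω Λ) (H' : Regular h (fun y x => c x y) Λ Ω)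
    {C₀ : ℝ} (hC₀ : 0 ≤ C₀) (hcurv : CurvatureBound g c Ω Λ C₀) (hxm : xm ∈ Ω) (hy : y ∈ Λ)
    (hP : A + θ • B = mom g c xm y) {x : M} (hx : x ∈ Ω)
    (hzero : deriv (mountain g c Λ xm A B x) θ = 0) :
    0 ≤ deriv (deriv (mountain g c Λ xm A B x)) θ ∧
    (0 < C₀ → x ≠ xm → B ≠ 0 → 0 < deriv (deriv (mountain g c Λ xm A B x)) θ) := by
  have h1 := H.contDiffAt_cost_arc hxm hy hP hx
  have h2 := H.contDiffAt_cost_arc hxm hy hP hxm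
  have e1 : deriv (mountain g c Λ xm A B x) θ = -deriv (fun t => c x (arc g c Λ xm A B t)) θ
      + deriv (fun t => c xm (arc g c Λ xm A B t)) θ := by
    rw [← deriv.fun_neg]
    exact deriv_fun_add (h1.neg.differentiableAt (by norm_num)) (h2.differentiableAt (by norm_num))
  have e2 : deriv (deriv (mountain g c Λ xm A B x)) θ
      = -deriv (deriv fun t => c x (arc g c Λ xm A B t)) θ
      + deriv (deriv fun t => c xm (arc g c Λ xm A B t)) θ := by
    rw [← deriv_deriv_neg]
    exact deriv_deriv_add (h1.neg.of_le (by norm_num)) (h2.of_le (by norm_num))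
  rw [e1] at hzero
  have h3 := H.second_deriv_mountain H' hC₀ hcurv hxm hy hP hx (by linarith)
  rw [e2]
  exact ⟨by linarith [h3.1], fun a b c => by linarith [h3.2 a b c]⟩

/-- Where the first derivative of the sliding mountain vanishes, it is nonnegative on the right. -/
theorem deriv_mountain_right_of_zero (H : Regular g c Ω Λ) (H' : Regular h (fun y x => c x y) Λ Ω)
    {C₀ : ℝ} (hC₀ : 0 ≤ C₀) (hcurv : CurvatureBound g c Ω Λ C₀) (hxm : xm ∈ Ω) (hy : y ∈ Λ)
    (hP : A + θ • B = mom g c xm y) (hB : B ≠ 0) {x : M} (hx : x ∈ Ω)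
    (hzero : deriv (mountain g c Λ xm A B x) θ = 0) :
    ∀ᶠ t in 𝓝[>] θ, 0 ≤ deriv (mountain g c Λ xm A B x) t := by
  set w := arcChart g c Λ xm A B y with hw
  set z₀ : Euc n := extChartAt (𝓡 n) x x with hz₀
  set zm : Euc n := extChartAt (𝓡 n) xm xm with hzm
  set f : Euc n × Euc n → ℝ := costInChart c x y with hf
  have hwd : ContDiffAt ℝ 3 w θ := H.contDiffAt_arcChart hxm hy hP
  have hwθ : w θ = extChartAt (𝓡 n) y y := H.arcChart_eq hxm hy hP
  obtain ⟨u, hu⟩ : ∃ u : Euc n, dirD (0, deriv w θ) (dirD (u, 0) f) (chartPt n x y) < 0 := by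
    by_contra! hcon
    refine H.velocity_ne_zero hxm hy hP hB (H.nondeg x hx y hy _ fun u => ?_)
    have hc2 : ContDiffAt ℝ 2 f (chartPt n x y) := (H.contDiffAt x hx y hy).of_le (by norm_num)
    have h1 := hcon u
    have h2 := hcon (-u)
    rw [dirD_dirD hc2] at h1 h2
    rw [show ((-u, 0) : Euc n × Euc n) = -(u, 0) by simp, map_neg] at h2
    rw [dirD_dirD hc2]
    linarith
  let F : ℝ × ℝ → ℝ := fun p => -f (z₀ + p.2 • u, w p.1) + costInChart c xm y (zm, w p.1)
  have hfF : ContDiffAt ℝ 4 f (z₀ + (0 : ℝ) • u, w θ) := by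
    rw [zero_smul, add_zero, hwθ]
    exact H.contDiffAt x hx y hy
  have hfm : ContDiffAt ℝ 4 (costInChart c xm y) (zm, w θ) := by
    rw [hwθ]
    exact H.contDiffAt xm hxm y hy
  have hw1 : ContDiffAt ℝ 3 (fun p : ℝ × ℝ => w p.1) (θ, 0) :=
    ContDiffAt.comp (g := w) (θ, (0 : ℝ)) hwd contDiffAt_fst
  have hF : ContDiffAt ℝ 3 F (θ, 0) := by
    have h1 : ContDiffAt ℝ 3 (fun p : ℝ × ℝ => z₀ + p.2 • u) (θ, 0) := by fun_prop
    have h2 : ContDiffAt ℝ 3 (fun p : ℝ × ℝ => f (z₀ + p.2 • u, w p.1)) (θ, 0) :=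
      ContDiffAt.comp (g := f) (θ, (0 : ℝ)) (hfF.of_le (by norm_num)) (h1.prodMk hw1)
    have h3 : ContDiffAt ℝ 3 (fun p : ℝ × ℝ => costInChart c xm y (zm, w p.1)) (θ, 0) :=
      ContDiffAt.comp (g := costInChart c xm y) (θ, (0 : ℝ)) (hfm.of_le (by norm_num))
        (contDiffAt_const.prodMk hw1)
    exact h2.neg.add h3
  have hFm : ∀ᶠ t in 𝓝 θ, ∀ r, F (t, r)
      = mountain g c Λ xm A B ((extChartAt (𝓡 n) x).symm (z₀ + r • u)) t := by
    filter_upwards [H.eventually_symm_arcChart hxm hy hP] with t ht r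
    simp only [F, hf, costInChart, mountain, hzm, extChartAt_to_inv]
    rw [ht]
  have hfst : Tendsto (fun p : ℝ × ℝ => p.1) (𝓝 (θ, 0)) (𝓝 θ) := continuousAt_fst
  have hFd : ∀ᶠ p in 𝓝 (θ, (0 : ℝ)),
      dirD (1, 0) F p = deriv (mountain g c Λ xm A B
        ((extChartAt (𝓡 n) x).symm (z₀ + p.2 • u))) p.1 ∧
      dirD (1, 0) (dirD (1, 0) F) p = deriv (deriv (mountain g c Λ xm A B
        ((extChartAt (𝓡 n) x).symm (z₀ + p.2 • u)))) p.1 := by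
    have h1 : ∀ᶠ p in 𝓝 (θ, (0 : ℝ)), ∀ᶠ t in 𝓝 p.1, ∀ r, F (t, r)
        = mountain g c Λ xm A B ((extChartAt (𝓡 n) x).symm (z₀ + r • u)) t :=
      hfst.eventually hFm.eventually_nhds
    filter_upwards [h1, eventually_contDiffAt (k := 3) hF] with p hp hFp
    obtain ⟨t, r⟩ := p
    have he : mountain g c Λ xm A B ((extChartAt (𝓡 n) x).symm (z₀ + r • u)) =ᶠ[𝓝 t]
        fun s => F (s, r) := by
      filter_upwards [hp] with s hs using (hs r).symm
    have e1 := deriv_left (w := id) (t := t) (z := r) (hFp.differentiableAt (by norm_num))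
      differentiableAt_id
    have e2 := deriv_deriv_left (w := id) (t := t) (z := r) (f := F) (hFp.of_le (by norm_num))
      contDiffAt_id
    have e3 : deriv (id : ℝ → ℝ) = fun _ => 1 := funext fun s => deriv_id s
    simp only [e3, deriv_const, id] at e1 e2
    rw [he.deriv_eq, he.deriv.deriv_eq, e1, e2, dirQ]
    refine ⟨rfl, ?_⟩
    have e4 : dirD ((0 : ℝ), (0 : ℝ)) F (t, r) = 0 := map_zero (fderiv ℝ F (t, r))
    rw [e4, add_zero]
  have hx0 : (extChartAt (𝓡 n) x).symm (z₀ + (0 : ℝ) • u) = x := by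
    rw [zero_smul, add_zero, hz₀, extChartAt_to_inv]
  have hmain : ∀ᶠ t in 𝓝[>] θ, 0 ≤ dirD (1, 0) F (t, 0) := by
    refine eventually_nonneg_of_family (contDiffAt_dirD hF (by norm_num) _) ?_ ?_ ?_
    · rw [hFd.self_of_nhds.1, hx0, hzero]
    · have hFθ : (fun t => dirD (0, 1) F (t, 0)) =ᶠ[𝓝 θ] fun t => -dirD (u, 0) f (z₀, w t) := by
        have hc1 : ContinuousAt (fun t : ℝ => (t, (0 : ℝ))) θ := by fun_prop
        have hc2 : ContinuousAt (fun t : ℝ => (z₀, w t)) θ :=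
          continuousAt_const.prodMk hwd.continuousAt
        have hfF' : ContDiffAt ℝ 4 f (z₀, w θ) := by
          rwa [zero_smul, add_zero] at hfF
        filter_upwards [hc1.eventually (eventually_contDiffAt (k := 3) hF),
          hc2.eventually (eventually_contDiffAt (k := 4) hfF')] with t h1 h2
        have e1 := deriv_right (w := id) (t := (0 : ℝ)) (z := t) (f := F)
          (h1.differentiableAt (by norm_num)) differentiableAt_id
        rw [deriv_id] at e1
        have h3 : HasDerivAt (fun r : ℝ => (z₀ + r • u, w t)) (u, (0 : Euc n)) 0 := by
          have h4 := ((hasDerivAt_id (0 : ℝ)).smul_const u).const_add z₀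
          rw [one_smul] at h4
          exact h4.prodMk (hasDerivAt_const 0 (w t))
        have h2' : HasFDerivAt f (fderiv ℝ f (z₀, w t)) (z₀ + (0 : ℝ) • u, w t) := by
          rw [zero_smul, add_zero]
          exact (h2.differentiableAt (by norm_num)).hasFDerivAt
        have h5 := ((h2'.comp_hasDerivAt (0 : ℝ) h3).neg.add_const
          (costInChart c xm y (zm, w t))).deriv
        exact e1.symm.trans h5
      have hc1 : DifferentiableAt ℝ (dirD (0, 1) F) (θ, 0) :=
        (contDiffAt_dirD (m := 1) hF (by norm_num) _).differentiableAt one_ne_zero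
      rw [dirD_comm (hF.of_le (by norm_num))]
      have e1 := deriv_left (w := id) (t := θ) (z := (0 : ℝ)) hc1 differentiableAt_id
      rw [deriv_id] at e1
      have hc2 : DifferentiableAt ℝ (dirD (u, 0) f) (z₀, w θ) := by
        rw [hwθ]
        exact (contDiffAt_dirD (m := 1) (H.contDiffAt x hx y hy) (by norm_num) _).differentiableAt
          one_ne_zero
      have e2 := deriv_right (w := w) (t := θ) (z := z₀) hc2 (hwd.differentiableAt (by norm_num))
      rw [hwθ] at e2
      have e3 : deriv (fun t => dirD (0, 1) F (t, 0)) θ = dirD (1, 0) (dirD (0, 1) F) (θ, 0) := e1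
      rw [← e3, hFθ.deriv_eq, deriv.fun_neg, e2]
      exact neg_pos.2 hu
    · have hmem : ∀ᶠ p in 𝓝 (θ, (0 : ℝ)),
          (extChartAt (𝓡 n) x).symm (z₀ + p.2 • u) ∈ Ω := by
        have hc : Tendsto (fun p : ℝ × ℝ => z₀ + p.2 • u) (𝓝 (θ, 0)) (𝓝 z₀) := by
          have hc' : ContinuousAt (fun p : ℝ × ℝ => z₀ + p.2 • u) (θ, 0) := by fun_prop
          simpa [ContinuousAt] using hc'
        exact hc.eventually (eventually_symm_mem H.isOpen_left hx)
      have hdom : ∀ᶠ p in 𝓝 (θ, (0 : ℝ)), A + p.1 • B ∈ mom g c xm '' Λ :=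
        hfst.eventually ((H.eventually_arc hxm hy hP).mono fun t ht => ht.1)
      filter_upwards [hFd, hmem, hdom] with p hp hpΩ hpd _ hp0
      rw [hp.2]
      rw [hp.1] at hp0
      exact (H.deriv_deriv_mountain H' hC₀ hcurv hxm (cE_mem hpd) (mom_cE hpd).symm hpΩ hp0).1
  have hcont : Tendsto (fun t : ℝ => (t, (0 : ℝ))) (𝓝[>] θ) (𝓝 (θ, 0)) := by
    have h1 : ContinuousAt (fun t : ℝ => (t, (0 : ℝ))) θ := by fun_prop
    exact h1.tendsto.mono_left nhdsWithin_le_nhds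
  filter_upwards [hmain, hcont.eventually hFd] with t h1 h2
  rw [h2.1] at h1
  simpa only [hx0] using h1

/-- Monotonicity of the superlevel sets of the derivative of the sliding mountain. -/
theorem deriv_mountain_nonneg (H : Regular g c Ω Λ) (H' : Regular h (fun y x => c x y) Λ Ω)
    {C₀ : ℝ} (hC₀ : 0 ≤ C₀) (hcurv : CurvatureBound g c Ω Λ C₀) (hxm : xm ∈ Ω) {θ₁ θ₂ : ℝ}
    (hdom : ∀ t ∈ Icc θ₁ θ₂, A + t • B ∈ mom g c xm '' Λ) {x : M} (hx : x ∈ Ω)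
    (h1 : 0 ≤ deriv (mountain g c Λ xm A B x) θ₁) :
    ∀ t ∈ Icc θ₁ θ₂, 0 ≤ deriv (mountain g c Λ xm A B x) t := by
  by_cases hB : B = 0
  · intro t _
    have : mountain g c Λ xm A B x = fun _ => mountain g c Λ xm A B x 0 := by
      funext s
      simp [mountain, arc, hB]
    rw [this, deriv_const]
  · refine nonneg_of_right_of_zeros (fun t ht => ?_) h1 fun t ht h0 => ?_
    · have hd := H.contDiffAt_mountain hxm (cE_mem (hdom t ht)) (mom_cE (hdom t ht)).symm hx
      exact (contDiffAt_deriv (m := 2) hd (by norm_num)).continuousAt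
    · have ht' := hdom t (Ico_subset_Icc_self ht)
      exact H.deriv_mountain_right_of_zero H' hC₀ hcurv hxm (cE_mem ht') (mom_cE ht').symm hB hx h0

/-- Under a positive curvature bound, the derivative of the sliding mountain at `x ≠ x_m` has at
most one zero. -/
theorem eq_of_deriv_mountain_eq_zero (H : Regular g c Ω Λ)
    (H' : Regular h (fun y x => c x y) Λ Ω)
    {C₀ : ℝ} (hC₀ : 0 < C₀) (hcurv : CurvatureBound g c Ω Λ C₀) (hxm : xm ∈ Ω) {θ₁ θ₂ : ℝ}
    (hlt : θ₁ < θ₂) (hdom : ∀ t ∈ Icc θ₁ θ₂, A + t • B ∈ mom g c xm '' Λ) (hB : B ≠ 0)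
    {x : M} (hx : x ∈ Ω) (h1 : deriv (mountain g c Λ xm A B x) θ₁ = 0)
    (h2 : deriv (mountain g c Λ xm A B x) θ₂ = 0) : x = xm := by
  by_contra hne
  have hd := hdom θ₂ ⟨hlt.le, le_rfl⟩
  have hpos := (H.deriv_deriv_mountain H' hC₀.le hcurv hxm (cE_mem hd) (mom_cE hd).symm hx h2).2
    hC₀ hne hB
  have hder : HasDerivAt (deriv (mountain g c Λ xm A B x)) _ θ₂ :=
    (differentiableAt_deriv ((H.contDiffAt_mountain hxm (cE_mem hd)
      (mom_cE hd).symm hx).of_le (by norm_num))).hasDerivAt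
  obtain ⟨t, ht1, ht2⟩ :=
    ((eventually_neg_left hder hpos h2).and (Ioo_mem_nhdsLT hlt)).exists
  have := H.deriv_mountain_nonneg H' hC₀.le hcurv hxm hdom hx h1.ge t
    ⟨ht2.1.le, ht2.2.le⟩
  linarith

end Regular

end Mountain

section Hypotheses

variable {n : ℕ}
  {M : Type*} [TopologicalSpace M] [ChartedSpace (Euc n) M] [IsManifold (𝓡 n) ∞ M]
  {N : Type*} [TopologicalSpace N] [ChartedSpace (Euc n) N] [IsManifold (𝓡 n) ∞ N]
  {g : RMetric n M} {h : RMetric n N} {c : M → N → ℝ} {Ω : Set M} {Λ : Set N}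

theorem A0.contMDiffAt (hA0 : A0 n c Ω Λ) (hΩ : IsOpen Ω) (hΛ : IsOpen Λ) {x : M} (hx : x ∈ Ω)
    {y : N} (hy : y ∈ Λ) :
    ContMDiffAt ((𝓡 n).prod (𝓡 n)) 𝓘(ℝ, ℝ) 4 (fun p : M × N => c p.1 p.2) (x, y) :=
  hA0.1.contMDiffAt ((hΩ.prod hΛ).mem_nhds ⟨hx, hy⟩)

theorem A0.smoothCost (hA0 : A0 n c Ω Λ) (hΩ : IsOpen Ω) (hΛ : IsOpen Λ) : SmoothCost n c Ω Λ where
  isOpen_left := hΩ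
  isOpen_right := hΛ
  contDiffAt x hx y hy := by
    have h1 := (contMDiffAt_iff.1 (hA0.contMDiffAt hΩ hΛ hx hy)).2
    rw [ModelWithCorners.range_eq_univ, contDiffWithinAt_univ, extChartAt_prod] at h1
    exact h1
  mdifferentiableAt x hx y hy := by
    have h1 : ContMDiffAt (𝓡 n) 𝓘(ℝ, ℝ) 4 (fun x' : M => c x' y) x :=
      ContMDiffAt.comp (g := fun p : M × N => c p.1 p.2) x (hA0.contMDiffAt hΩ hΛ hx hy)
        (contMDiffAt_id.prodMk contMDiffAt_const)
    exact h1.mdifferentiableAt (by norm_num)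

theorem A0.smoothCost_swap (hA0 : A0 n c Ω Λ) (hΩ : IsOpen Ω) (hΛ : IsOpen Λ) :
    SmoothCost n (fun y x => c x y) Λ Ω where
  isOpen_left := hΛ
  isOpen_right := hΩ
  contDiffAt y hy x hx := by
    have h1 := (hA0.smoothCost hΩ hΛ).contDiffAt x hx y hy
    rw [costInChart_swap]
    exact ContDiffAt.comp (g := costInChart c x y) (chartPt n y x) h1
      (contDiffAt_snd.prodMk contDiffAt_fst)
  mdifferentiableAt y hy x hx := by
    have h1 : ContMDiffAt (𝓡 n) 𝓘(ℝ, ℝ) 4 (fun y' : N => c x y') y :=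
      ContMDiffAt.comp (g := fun p : M × N => c p.1 p.2) y (hA0.contMDiffAt hΩ hΛ hx hy)
        (contMDiffAt_const.prodMk contMDiffAt_id)
    exact h1.mdifferentiableAt (by norm_num)

theorem SmoothCost.continuousAt_mom (H : SmoothCost n c Ω Λ) (g : RMetric n M) {x : M} (hx : x ∈ Ω)
    {y : N} (hy : y ∈ Λ) : ContinuousAt (mom g c x) y := by
  obtain ⟨e, he⟩ := exists_equiv_of_injective _ (metricAt_injective g x)
  set ψ := extChartAt (𝓡 n) y with hψ
  let K : Euc n → (Euc n →L[ℝ] ℝ) := fun w =>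
    -((fderiv ℝ (costInChart c x y) (extChartAt (𝓡 n) x x, w)).comp
      (ContinuousLinearMap.inl ℝ (Euc n) (Euc n)))
  have hK : ContinuousAt K (ψ y) := by
    have h1 : ContinuousAt (fderiv ℝ (costInChart c x y)) (chartPt n x y) :=
      ((H.contDiffAt x hx y hy).fderiv_right (m := 3) (by norm_num)).continuousAt
    have h2 : ContinuousAt (fun w : Euc n => (extChartAt (𝓡 n) x x, w)) (ψ y) := by fun_prop
    have h3 : ContinuousAt (fun w : Euc n => fderiv ℝ (costInChart c x y)
        (extChartAt (𝓡 n) x x, w)) (ψ y) :=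
      ContinuousAt.comp (g := fderiv ℝ (costInChart c x y)) h1 h2
    exact (h3.clm_comp continuousAt_const).neg
  have hψc : ContinuousAt ψ y := continuousAt_extChartAt y
  have h4 : ContinuousAt (fun y' => e.symm (K (ψ y'))) y :=
    e.symm.continuous.continuousAt.comp (ContinuousAt.comp (g := K) hK hψc)
  refine h4.congr ?_
  filter_upwards [hψc.eventually (H.eventually_metricAt_mom g hx hy),
    extChartAt_source_mem_nhds (I := 𝓡 n) y] with y' h5 h6
  rw [ψ.left_inv h6] at h5
  rw [e.symm_apply_eq]
  have h7 : e (mom g c x y') = metricAt g x (mom g c x y') := by rw [← he]; rfl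
  rw [h7]
  ext u
  rw [h5 u]
  simp [K, dirD]

theorem Twist.injOn (hT : Twist g c Ω Λ) (H : SmoothCost n c Ω Λ) {x : M} (hx : x ∈ Ω) :
    InjOn (mom g c x) Λ := by
  have key : ∀ y ∈ Λ, extendFrom Λ (momentum g c x) y = momentum g c x y := by
    intro y hy
    have h1 : Tendsto (mom g c x) (𝓝[Λ] y) (𝓝 (mom g c x y)) :=
      (H.continuousAt_mom g hx hy).tendsto.mono_left nhdsWithin_le_nhds
    have h2 : extendFrom Λ (mom g c x) y = mom g c x y := extendFrom_eq (subset_closure hy) h1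
    exact h2
  intro y hy y' hy' hyy'
  refine hT x hx (subset_closure hy) (subset_closure hy') ?_
  rw [key y hy, key y' hy']
  exact hyy'

theorem bilin_eq_zero_of_det_ne_zero (β : Euc n →L[ℝ] Euc n →L[ℝ] ℝ)
    (hdet : (Matrix.of fun i j : Fin n => β (EuclideanSpace.single j (1 : ℝ))
      (EuclideanSpace.single i (1 : ℝ))).det ≠ 0) :
    (∀ v, (∀ u, β v u = 0) → v = 0) ∧ (∀ u, (∀ v, β v u = 0) → u = 0) := by
  have hsum : ∀ v : Euc n, v = ∑ j, v j • EuclideanSpace.single j (1 : ℝ) := fun v => by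
    have := (EuclideanSpace.basisFun (Fin n) ℝ).sum_repr v
    simp only [EuclideanSpace.basisFun_repr, EuclideanSpace.basisFun_apply] at this
    exact this.symm
  constructor
  · intro v hv
    have h1 := Matrix.eq_zero_of_mulVec_eq_zero hdet (v := fun j => v j) (by
      funext i
      have h2 := hv (EuclideanSpace.single i (1 : ℝ))
      rw [hsum v] at h2
      simp only [map_sum, map_smul, sum_apply, smul_apply,
        smul_eq_mul] at h2
      simp only [Matrix.mulVec, dotProduct, Matrix.of_apply, Pi.zero_apply]
      rw [← h2]
      exact Finset.sum_congr rfl fun j _ => mul_comm _ _)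
    ext j
    exact congrFun h1 j
  · intro u hu
    have h1 := Matrix.eq_zero_of_vecMul_eq_zero hdet (v := fun j => u j) (by
      funext j
      have h2 := hu (EuclideanSpace.single j (1 : ℝ))
      rw [hsum u] at h2
      simp only [map_sum, map_smul, smul_eq_mul] at h2
      simp only [Matrix.vecMul, dotProduct, Matrix.of_apply, Pi.zero_apply]
      exact h2)
    ext j
    exact congrFun h1 j

theorem A2.det_mixedHess_ne_zero (hA2 : A2 n c Ω Λ) (H : SmoothCost n c Ω Λ) {x : M} (hx : x ∈ Ω)
    {y : N} (hy : y ∈ Λ) : (mixedHess n c x y (x, y)).det ≠ 0 := by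
  have h1 : ContinuousAt (mixedHess n c x y) (x, y) := by
    have h2 : ContinuousAt (fderiv ℝ (fderiv ℝ (costInChart c x y))) (chartPt n x y) :=
      (((H.contDiffAt x hx y hy).fderiv_right (m := 3) (by norm_num)).fderiv_right
        (m := 2) (by norm_num)).continuousAt
    have h3 : ContinuousAt (fun p : M × N => (extChartAt (𝓡 n) x p.1, extChartAt (𝓡 n) y p.2))
        (x, y) :=
      ((continuousAt_extChartAt (I := 𝓡 n) x).comp_of_eq continuousAt_fst rfl).prodMk
        ((continuousAt_extChartAt (I := 𝓡 n) y).comp_of_eq continuousAt_snd rfl)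
    have h4 : ContinuousAt (fun p : M × N => fderiv ℝ (fderiv ℝ (costInChart c x y))
        (extChartAt (𝓡 n) x p.1, extChartAt (𝓡 n) y p.2)) (x, y) :=
      ContinuousAt.comp (g := fderiv ℝ (fderiv ℝ (costInChart c x y))) h2 h3
    refine continuousAt_pi.2 fun i => continuousAt_pi.2 fun j => ?_
    exact (h4.clm_apply continuousAt_const).clm_apply continuousAt_const
  have h2 := hA2 x (subset_closure hx) y (subset_closure hy)
  rwa [extendFrom_eq (subset_closure (mk_mem_prod hx hy))
    (h1.tendsto.mono_left nhdsWithin_le_nhds)] at h2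

theorem A2.nondeg (hA2 : A2 n c Ω Λ) (H : SmoothCost n c Ω Λ) {x : M} (hx : x ∈ Ω)
    {y : N} (hy : y ∈ Λ) :
    (∀ v : Euc n, (∀ u : Euc n,
      dirD (0, v) (dirD (u, 0) (costInChart c x y)) (chartPt n x y) = 0) → v = 0) ∧
    (∀ u : Euc n, (∀ v : Euc n,
      dirD (0, v) (dirD (u, 0) (costInChart c x y)) (chartPt n x y) = 0) → u = 0) := by
  have hc : ContDiffAt ℝ 2 (costInChart c x y) (chartPt n x y) :=
    (H.contDiffAt x hx y hy).of_le (by norm_num)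
  simp only [dirD_dirD hc]
  exact bilin_eq_zero_of_det_ne_zero ((fderiv ℝ (fderiv ℝ (costInChart c x y))
    (chartPt n x y)).bilinearComp (ContinuousLinearMap.inr ℝ (Euc n) (Euc n))
      (ContinuousLinearMap.inl ℝ (Euc n) (Euc n))) (hA2.det_mixedHess_ne_zero H hx hy)

theorem regular_of_hypotheses (hΩ : IsOpen Ω) (hΛ : IsOpen Λ) (hA0 : A0 n c Ω Λ)
    (hA1 : A1 g h c Ω Λ) (hA2 : A2 n c Ω Λ) (hΛconv : CConvex g c Ω Λ) : Regular g c Ω Λ where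
  toSmoothCost := hA0.smoothCost hΩ hΛ
  nondeg _ hx _ hy := (hA2.nondeg (hA0.smoothCost hΩ hΛ) hx hy).1
  injOn _ hx := hA1.1.injOn (hA0.smoothCost hΩ hΛ) hx
  convex x hx := hΛconv x hx

theorem regular_swap_of_hypotheses (hΩ : IsOpen Ω) (hΛ : IsOpen Λ) (hA0 : A0 n c Ω Λ)
    (hA1 : A1 g h c Ω Λ) (hA2 : A2 n c Ω Λ) (hΩconv : CConvex h (fun y x => c x y) Λ Ω) :
    Regular h (fun y x => c x y) Λ Ω where
  toSmoothCost := hA0.smoothCost_swap hΩ hΛ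
  nondeg y hy x hx u hu := by
    have H := hA0.smoothCost hΩ hΛ
    refine (hA2.nondeg H hx hy).2 u fun v => ?_
    have h1 := hu v
    rw [costInChart_swap, dirD_comp_swap, dirD_comp_swap] at h1
    rw [dirD_comm ((H.contDiffAt x hx y hy).of_le (by norm_num))]
    exact h1
  injOn _ hy := hA1.2.injOn (hA0.smoothCost_swap hΩ hΛ) hy
  convex y hy := hΩconv y hy

theorem slidingMountain_eq [Nonempty N] (g : RMetric n M) (c : M → N → ℝ) (Λ : Set N) (xm x : M)
    (y₀ y₁ : N) : (fun s => slidingMountain g c Λ xm y₀ y₁ s x)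
      = mountain g c Λ xm (mom g c xm y₀) (mom g c xm y₁ - mom g c xm y₀) x := by
  funext s
  have h1 : cSegment g c Λ xm y₀ y₁ s
      = arc g c Λ xm (mom g c xm y₀) (mom g c xm y₁ - mom g c xm y₀) s := by
    have h2 : (1 - s) • mom g c xm y₀ + s • mom g c xm y₁
        = mom g c xm y₀ + s • (mom g c xm y₁ - mom g c xm y₀) := by module
    rw [arc, ← h2]
    rfl
  rw [slidingMountain, h1, mountain]

theorem Regular.segment_mem (H : Regular g c Ω Λ) {xm : M} (hxm : xm ∈ Ω) {y₀ y₁ : N} (hy₀ : y₀ ∈ Λ)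
    (hy₁ : y₁ ∈ Λ) {s : ℝ} (h0 : 0 ≤ s) (h1 : s ≤ 1) :
    mom g c xm y₀ + s • (mom g c xm y₁ - mom g c xm y₀) ∈ mom g c xm '' Λ := by
  have hc := H.convex xm hxm (mem_image_of_mem _ hy₀) (mem_image_of_mem _ hy₁)
    (sub_nonneg.2 h1) h0 (by ring)
  convert hc using 1
  module

theorem Regular.monotonicity [Nonempty M] [Nonempty N] (H : Regular g c Ω Λ)
    (H' : Regular h (fun y x => c x y) Λ Ω) {C₀ : ℝ} (hC₀ : 0 ≤ C₀)
    (hcurv : CurvatureBound g c Ω Λ C₀) {xm : M} (hxm : xm ∈ Ω) {y₀ y₁ : N} (hy₀ : y₀ ∈ Λ)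
    (hy₁ : y₁ ∈ Λ) : Monotonicity g c Ω Λ xm y₀ y₁ := by
  rintro θ₁ θ₂ h0 h12 h1 x ⟨hx, hpos⟩
  rw [slidingMountain_eq] at hpos
  refine ⟨hx, ?_⟩
  rw [slidingMountain_eq]
  exact H.deriv_mountain_nonneg H' hC₀ hcurv hxm
    (fun t ht => H.segment_mem hxm hy₀ hy₁ (h0.trans ht.1) (ht.2.trans h1)) hx hpos θ₂ ⟨h12, le_rfl⟩

theorem Regular.strictMonotonicity [Nonempty M] [Nonempty N] (H : Regular g c Ω Λ)
    (H' : Regular h (fun y x => c x y) Λ Ω) {C₀ : ℝ} (hC₀ : 0 < C₀)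
    (hcurv : CurvatureBound g c Ω Λ C₀) {xm : M} (hxm : xm ∈ Ω) {y₀ y₁ : N} (hy₀ : y₀ ∈ Λ)
    (hy₁ : y₁ ∈ Λ) (hne : y₀ ≠ y₁) : StrictMonotonicity g c Ω Λ xm y₀ y₁ := by
  refine ⟨H.monotonicity H' hC₀.le hcurv hxm hy₀ hy₁, fun θ₁ θ₂ h0 h12 h1 => ?_⟩
  have hxm' : ∀ θ, xm ∈ levelSet g c Ω Λ xm y₀ y₁ θ := fun θ => by
    refine ⟨hxm, ?_⟩
    have : (fun s => slidingMountain g c Λ xm y₀ y₁ s xm) = fun _ => 0 := by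
      funext s
      simp [slidingMountain]
    rw [this, deriv_const]
  refine Subset.antisymm ?_ (singleton_subset_iff.2 ⟨hxm' θ₁, hxm' θ₂⟩)
  rintro x ⟨⟨hx, hz1⟩, ⟨-, hz2⟩⟩
  rw [slidingMountain_eq] at hz1 hz2
  have hB : mom g c xm y₁ - mom g c xm y₀ ≠ 0 := fun h2 =>
    hne (H.injOn xm hxm hy₁ hy₀ (sub_eq_zero.1 h2)).symm
  exact H.eq_of_deriv_mountain_eq_zero H' hC₀ hcurv hxm h12
    (fun t ht => H.segment_mem hxm hy₀ hy₁ (h0.trans ht.1) (ht.2.trans h1)) hB hx hz1 hz2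

end Hypotheses

end

end CostTransport

theorem theorem5p3 {n : ℕ}
    {M : Type*} [TopologicalSpace M] [T2Space M] [ChartedSpace (CostTransport.Euc n) M]
    [IsManifold (𝓡 n) ∞ M]
    {N : Type*} [TopologicalSpace N] [T2Space N] [ChartedSpace (CostTransport.Euc n) N]
    [IsManifold (𝓡 n) ∞ N] [Nonempty N]
    (g : CostTransport.RMetric n M) (h : CostTransport.RMetric n N)
    (Ω : Set M) (hΩo : IsOpen Ω) (hΩc : IsConnected Ω)
    (Λ : Set N) (hΛo : IsOpen Λ) (hΛc : IsConnected Λ)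
    (c : M → N → ℝ)
    (hA0 : CostTransport.A0 n c Ω Λ)
    (hA1 : CostTransport.A1 g h c Ω Λ)
    (hA2 : CostTransport.A2 n c Ω Λ)
    (hΛconv : CostTransport.CConvex g c Ω Λ)
    (hΩconv : CostTransport.CConvex h (fun y x => c x y) Λ Ω) :
    (CostTransport.A3W g c Ω Λ →
      ∀ xm ∈ Ω, ∀ y₀ ∈ Λ, ∀ y₁ ∈ Λ, CostTransport.Monotonicity g c Ω Λ xm y₀ y₁) ∧
    (CostTransport.A3S g c Ω Λ →
      ∀ xm ∈ Ω, ∀ y₀ ∈ Λ, ∀ y₁ ∈ Λ, y₀ ≠ y₁ →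
        CostTransport.StrictMonotonicity g c Ω Λ xm y₀ y₁) := by
  have H := CostTransport.regular_of_hypotheses hΩo hΛo hA0 hA1 hA2 hΛconv
  have H' := CostTransport.regular_swap_of_hypotheses hΩo hΛo hA0 hA1 hA2 hΩconv
  have : Nonempty M := ⟨hΩc.nonempty.some⟩
  constructor
  · rintro ⟨C₀, hC₀, hcurv⟩ xm hxm y₀ hy₀ y₁ hy₁
    exact H.monotonicity H' hC₀ hcurv hxm hy₀ hy₁
  · rintro ⟨C₀, hC₀, hcurv⟩ xm hxm y₀ hy₀ y₁ hy₁ hne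
    exact H.strictMonotonicity H' hC₀ hcurv hxm hy₀ hy₁ hne
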